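/- **Setting.** Let $(X_i,Y_i)_{i\ge 1}$ be i.i.d. copies of $(X,Y)\in\mathbb R^d\times\mathbb R$, $d\ge1$, where $$Y=m_0(\theta_0^\top X)+\epsilon,\qquad \mathbb E(\epsilon\mid X)=0 \text{ a.s.}$$ Let $|\cdot|$ be the Euclidean norm, $\Theta=\{\eta\in\mathbb R^d: |\eta|=1,\ \eta_1\ge 0\}$, let $\chi$ be the support of $X$, let $P_X$ be the law of $X$, $\|g\|^2=\int g^2\,dP_X$, and $D=\{\theta^\top x: x\in\chi,\ \theta\in\Theta\}$. For $L\ge0$ let $\mathcal M_L$ be the class of real-valued convex functions on $D$ that are Lipschitz with constant $L$. A Lipschitz constrained least squares estimator (LLSE) is any minimizer $$(\check m_n,\check\theta_n)\in\operatorname*{arg\,min}_{(m,\theta)\in\mathcal M_L\times\Theta}\ \frac1n\sum_{i=1}^n\{Y_i-m(\theta^\top X_i)\}^2 .$$ Write $(m\circ\theta)(x)=m(\theta^\top x)$. **Theorem.** Let $\theta_0\in\Theta$ and assume: 1. $\chi$ is compact. 2. There is $K_1>0$ with $K_1\,\mathbb E[\exp(\epsilon^2/K_1)-1\mid X]\le1$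 a.s. (and $\mathbb E(\epsilon\mid X)=0$ a.s.). 3. The matrix $\mathbb E[XX^\top\{m_0'(\theta_0^\top X)\}^2]$ is nonsingular, where $m_0'$ is the right derivative of $m_0$. 4. $\operatorname{Var}(X)$ is positive definite. 5. $m_0$ is convex on $D$, bounded on $D$ by a constant $M_0\ge1$, and Lipschitz on $D$ with constant $L_0$; and $L\ge L_0$. 6. $\theta_{0,1}>0$, and for some $d_1\in\{1,\dots,d\}$ the vector $(X^{(1)},\dots,X^{(d_1)})$ of the first $d_1$ coordinates of $X$ has a density with respect to Lebesgue measure on $\mathbb R^{d_1}$, while the coordinates $X^{(d_1+1)},\dots,X^{(d)}$ are discrete random variables. 7. The conditional distribution of $X$ given $\theta_0^\top X$ is nondegenerate, in the following sense: for every $v\in\mathbb R^d$ that is not a scalar multiple of $\theta_0$, for almost every value $t$ of $\theta_0^\top X$, the conditional distribution of $v^\top X$ given $\theta_0^\top X=t$ is not a point mass. Then, for every choice of the minimizers $(\check m_n,\check\theta_n)$, $$|\check\theta_n-\theta_0|=O_p(n^{-2/5})\qquad\text{and}\qquad \|\check m_n\circ\theta_0-m_0\circ\theta_0\|=O_p(n^{-2/5}),$$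 where $Z_n=O_p(r_n)$ means that for every $\varepsilon>0$ there is $M$ with $\mathbb P(|Z_n|>Mr_n)\le\varepsilon$ for all sufficiently large $n$ ($\mathbb P$ being outer probability if $Z_n$ is not measurable). -/

import Mathlib

open MeasureTheory ProbabilityTheory Filter
open scoped NNReal ENNReal

namespace ConvexSIM

/-- The parameter space `Θ`: unit vectors of `ℝ^d` with nonnegative first coordinate. -/
def paramSpace (d : ℕ) [NeZero d] : Set (EuclideanSpace ℝ (Fin d)) :=
  {η | ‖η‖ = 1 ∧ 0 ≤ η 0}

/-- The index set `D = {θᵀx : x ∈ χ, θ ∈ Θ}`. -/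
def indexSet {d : ℕ} [NeZero d] (χ : Set (EuclideanSpace ℝ (Fin d))) : Set ℝ :=
  {t | ∃ x ∈ χ, ∃ θ ∈ paramSpace d, inner ℝ θ x = t}

/-- The class `M_L` of convex `L`-Lipschitz functions on `D`. Functions on `D` are represented by
functions on `ℝ`, whose values off `D` are irrelevant. -/
def linkClass (D : Set ℝ) (L : ℝ≥0) : Set (ℝ → ℝ) :=
  {m | ConvexOn ℝ D m ∧ LipschitzOnWith L m D}

/-- The least squares criterion `Q_n(m, θ) = n⁻¹ ∑_{i<n} (y_i - m(θᵀx_i))²`. -/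
noncomputable def lsCriterion {d : ℕ} (n : ℕ) (x : ℕ → EuclideanSpace ℝ (Fin d)) (y : ℕ → ℝ)
    (m : ℝ → ℝ) (θ : EuclideanSpace ℝ (Fin d)) : ℝ :=
  (1 / (n : ℝ)) * ∑ i ∈ Finset.range n, (y i - m (inner ℝ θ (x i))) ^ 2

/-- `(m, θ)` is a Lipschitz constrained least squares estimate for the first `n` data points:
a minimizer of `Q_n` over `M_L × Θ`. -/
def IsLLSE {d : ℕ} [NeZero d] (D : Set ℝ) (L : ℝ≥0) (n : ℕ)
    (x : ℕ → EuclideanSpace ℝ (Fin d)) (y : ℕ → ℝ)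
    (m : ℝ → ℝ) (θ : EuclideanSpace ℝ (Fin d)) : Prop :=
  m ∈ linkClass D L ∧ θ ∈ paramSpace d ∧
    ∀ m' ∈ linkClass D L, ∀ θ' ∈ paramSpace d,
      lsCriterion n x y m θ ≤ lsCriterion n x y m' θ'

/-- The right derivative of a function on `ℝ`. -/
noncomputable def rightDeriv (m : ℝ → ℝ) (t : ℝ) : ℝ := derivWithin m (Set.Ioi t) t

/-- The `L₂(μ)` norm. -/
noncomputable def l2norm {E : Type*} [MeasurableSpace E] (μ : Measure E) (g : E → ℝ) : ℝ :=
  Real.sqrt (∫ x, g x ^ 2 ∂μ)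

/-- `Z_n = O_p(r_n)`. Since no measurability of `Z_n` is required, `P` of the event
is its outer probability. -/
def IsBigOP {Ω : Type*} [MeasurableSpace Ω] (P : Measure Ω) (Z : ℕ → Ω → ℝ) (r : ℕ → ℝ) : Prop :=
  ∀ ε : ℝ, 0 < ε → ∃ M : ℝ, 0 < M ∧
    ∀ᶠ n in atTop, P {ω | M * r n < |Z n ω|} ≤ ENNReal.ofReal ε

/-- Nondegeneracy of the conditional distribution of `X` given `θᵀX`. That distribution always
lives on the hyperplane `{x : θᵀx = t}`; it is nondegenerate when, in every direction `v` that is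
not parallel to `θ`, for almost every `t` the functional `vᵀx` is not almost surely constant
under the conditional distribution given `θᵀX = t`. -/
def NondegenerateGivenIndex {Ω : Type*} [MeasurableSpace Ω] {d : ℕ} (P : Measure Ω)
    [IsFiniteMeasure P] (X : Ω → EuclideanSpace ℝ (Fin d)) (θ : EuclideanSpace ℝ (Fin d)) : Prop :=
  ∀ v : EuclideanSpace ℝ (Fin d), (∀ c : ℝ, v ≠ c • θ) →
    ∀ᵐ t ∂(P.map (fun ω => (inner ℝ θ (X ω) : ℝ))),
      ¬ ∃ a : ℝ, ∀ᵐ x ∂(condDistrib X (fun ω => (inner ℝ θ (X ω) : ℝ)) P t), inner ℝ v x = a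

/-- The first `d₁` coordinates of `X` have a joint Lebesgue density and
the remaining coordinates are discrete. -/
def ContinuousDiscrete {Ω : Type*} [MeasurableSpace Ω] {d : ℕ} (P : Measure Ω)
    (X : Ω → EuclideanSpace ℝ (Fin d)) (d₁ : ℕ) : Prop :=
  (P.map (fun ω (j : {j : Fin d // (j : ℕ) < d₁}) => X ω j) ≪ volume) ∧
    ∀ j : Fin d, d₁ ≤ (j : ℕ) → ∃ S : Set ℝ, S.Countable ∧ ∀ᵐ ω ∂P, X ω j ∈ S

end ConvexSIM

/-!
The proof has a statistical half, a rate for the regression function, and an analytic half, which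
passes from the regression function to its two components.

*Rate.* Residuals of a least squares fit sum to zero, since constants may be added to the link. With
large probability the fitted link is therefore bounded, and the fitted function
`f = m (θᵀ·)` lies in a fixed class of bounded single index functions with convex Lipschitz links.
This class has sup-norm nets at scale `h²` with `exp (C / h)` elements
(`exists_net_convex_lipschitz`, `exists_net_singleIndexClass`). The reason is that a convex function
is recovered from its Moreau envelope without loss in the sup norm, while the envelope has second
differences in `[0, h²]` on a grid of step `h`: rounded to multiples of `h² / 2`, it is described by
boundedly many choices per grid point. With `e` the noise, `f₀` the truth and `g = f - f₀`, optimality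
of the fit reads `∑ (2 e g - g²) ≥ 0`. Let `δ = n ^ (-2 / 5)`, so that `n δ² = δ ^ (-1 / 2)`. At the
net of accuracy `δ` the process `2 e g - g² / 2` has exponential moments that decay like
`exp (-κ n ∫ g²)`, and a union bound excludes `∫ g² ≥ M δ²`; the difference between `f` and its
approximation is handled by chaining through nets of accuracy `4⁻ᵏ δ` and the sub-Gaussian tails of
`∑ e h` for bounded `h`. No logarithms appear because, at every scale, the entropy is dominated by
the exponent available there. This is `exists_leastSquares_rate`.

*Separation.* The error of the index satisfies `‖θ - θ₀‖ ≤ c ‖m ∘ θ - m₀ ∘ θ₀‖`, with `c` uniform over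
the class (`exists_norm_sub_le_mul_l2norm`). If not, compactness gives a limit link `m` and a limit
index with `m ∘ θ = m₀ ∘ θ₀` almost everywhere. Such an identity can be differentiated along the first
coordinate, in whose direction `X` has a density (`ae_deriv_eq_of_ae_eq`), and with convexity and
nondegeneracy this forces `θ = θ₀` (`index_eq_of_ae_eq`). Passing to the limit in difference quotients
then shows that `m₀' (θ₀ᵀX) vᵀX` is a function of `θ₀ᵀX`, for a unit vector `v` orthogonal to `θ₀`.
By nondegeneracy `m₀' (θ₀ᵀX) = 0` almost surely, which contradicts the nonsingularity of
`E[X Xᵀ m₀' (θ₀ᵀX)²]`. Finally, replacing `θ` by `θ₀` inside a Lipschitz link costs at most a multiple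
of `‖θ - θ₀‖`, so that the link itself is estimated at the same rate.
-/

namespace ConvexSIM

/-! ### Convex extension and Moreau envelope -/

/-- A convex Lipschitz function on a set extends to the line as the infimal convolution
`t ↦ inf_{s ∈ D} (m s + L |t - s|)`, which keeps convexity and the Lipschitz constant. -/
theorem exists_convex_lipschitz_extension {D : Set ℝ} {L : ℝ≥0} {m : ℝ → ℝ} (hD : D.Nonempty)
    (hm : m ∈ linkClass D L) :
    ∃ m' : ℝ → ℝ, Set.EqOn m' m D ∧ ConvexOn ℝ Set.univ m' ∧ LipschitzWith L m' := by
  obtain ⟨hc, hl⟩ := hm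
  have hlip : ∀ s ∈ D, ∀ t ∈ D, m s ≤ m t + L * |s - t| := fun s hs t ht => by
    have := hl.dist_le_mul s hs t ht
    rw [Real.dist_eq, Real.dist_eq] at this
    linarith [le_abs_self (m s - m t)]
  have hne : Nonempty D := hD.to_subtype
  obtain ⟨s₀, hs₀⟩ := hD
  have hbdd : ∀ t, BddBelow (Set.range fun s : D => m s + L * |t - (s : ℝ)|) := fun t => by
    refine ⟨m s₀ - L * |t - s₀|, ?_⟩
    rintro _ ⟨⟨s, hs⟩, rfl⟩
    have h1 := hlip s₀ hs₀ s hs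
    have h2 : |s₀ - s| ≤ |t - s₀| + |t - s| := by
      rw [abs_sub_comm t s₀]; exact abs_sub_le _ _ _
    have := mul_le_mul_of_nonneg_left h2 L.coe_nonneg
    simp only
    linarith
  refine ⟨fun t => ⨅ s : D, m s + L * |t - (s : ℝ)|, ?_, ⟨convex_univ, ?_⟩, ?_⟩
  · intro t ht
    apply le_antisymm
    · simpa using ciInf_le (hbdd t) ⟨t, ht⟩
    · exact le_ciInf fun s => hlip t ht s s.2
  · intro x _ y _ a b ha hb hab
    refine le_of_forall_pos_le_add fun e he => ?_
    obtain ⟨⟨s, hs⟩, hs'⟩ := exists_lt_of_ciInf_lt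
      (lt_add_of_pos_right (⨅ s : D, m s + L * |x - (s : ℝ)|) he)
    obtain ⟨⟨t, ht⟩, ht'⟩ := exists_lt_of_ciInf_lt
      (lt_add_of_pos_right (⨅ s : D, m s + L * |y - (s : ℝ)|) he)
    have h1 := ciInf_le (hbdd (a • x + b • y)) ⟨a • s + b • t, hc.1 hs ht ha hb hab⟩
    have h2 := hc.2 hs ht ha hb hab
    simp only [smul_eq_mul] at *
    have h3 : |a * x + b * y - (a * s + b * t)| ≤ a * |x - s| + b * |y - t| := by
      rw [show a * x + b * y - (a * s + b * t) = a * (x - s) + b * (y - t) by ring]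
      refine (abs_add_le _ _).trans ?_
      rw [abs_mul, abs_mul, abs_of_nonneg ha, abs_of_nonneg hb]
    have h4 := mul_le_mul_of_nonneg_left h3 L.coe_nonneg
    have h5 := mul_le_mul_of_nonneg_left hs'.le ha
    have h6 := mul_le_mul_of_nonneg_left ht'.le hb
    have h7 : e = a * e + b * e := by rw [← add_mul, hab, one_mul]
    linarith
  · refine LipschitzWith.of_le_add_mul L fun x y => ?_
    rw [← sub_le_iff_le_add]
    refine le_ciInf fun s => ?_
    have h1 := ciInf_le (hbdd x) s
    have h2 : |x - (s : ℝ)| ≤ dist x y + |y - (s : ℝ)| := by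
      rw [Real.dist_eq]; exact abs_sub_le _ _ _
    have := mul_le_mul_of_nonneg_left h2 L.coe_nonneg
    linarith

theorem exists_subgradient {m : ℝ → ℝ} {L : ℝ≥0} (hc : ConvexOn ℝ Set.univ m)
    (hl : LipschitzWith L m) (t : ℝ) :
    ∃ g : ℝ, |g| ≤ L ∧ ∀ s, m t + g * (s - t) ≤ m s := by
  have hsub : ∀ s, m t + derivWithin m (Set.Ioi t) t * (s - t) ≤ m s := by
    intro s
    rcases lt_trichotomy s t with h | rfl | h
    · have h1 := hc.slope_le_leftDeriv_of_mem_interior (Set.mem_univ s) (by simp) h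
      have h2 := hc.leftDeriv_le_rightDeriv_of_mem_interior (x := t) (by simp)
      have h3 := h1.trans h2
      rw [slope_def_field, div_le_iff₀ (by linarith)] at h3
      linarith
    · simp
    · have h1 := hc.rightDeriv_le_slope_of_mem_interior (x := t) (by simp) (Set.mem_univ s) h
      rw [slope_def_field, le_div_iff₀ (by linarith)] at h1
      linarith
  refine ⟨_, ?_, hsub⟩
  have hlip : ∀ s, m s ≤ m t + L * |s - t| := fun s => by
    have := hl.dist_le_mul s t
    rw [Real.dist_eq, Real.dist_eq] at this
    linarith [le_abs_self (m s - m t)]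
  have h1 := (hsub (t + 1)).trans (hlip _)
  have h2 := (hsub (t - 1)).trans (hlip _)
  simp at h1 h2
  exact abs_le.2 ⟨by linarith, by linarith⟩

/-- The Moreau envelope `u ↦ inf_s (m s + (u - s)² / 2)`. -/
noncomputable def moreauEnvelope (m : ℝ → ℝ) (u : ℝ) : ℝ := ⨅ s : ℝ, (m s + (u - s) ^ 2 / 2)

section Moreau

variable {m : ℝ → ℝ} {L : ℝ≥0}

theorem moreauEnvelope_bddBelow (hc : ConvexOn ℝ Set.univ m) (hl : LipschitzWith L m) (u : ℝ) :
    BddBelow (Set.range fun s : ℝ => m s + (u - s) ^ 2 / 2) := by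
  obtain ⟨g, -, hg⟩ := exists_subgradient hc hl u
  refine ⟨m u - g ^ 2 / 2, ?_⟩
  rintro _ ⟨s, rfl⟩
  have := hg s
  simp only
  nlinarith [sq_nonneg (u - s - g)]

theorem moreauEnvelope_le (hc : ConvexOn ℝ Set.univ m) (hl : LipschitzWith L m) (u s : ℝ) :
    moreauEnvelope m u ≤ m s + (u - s) ^ 2 / 2 :=
  ciInf_le (moreauEnvelope_bddBelow hc hl u) s

/-- A convex function is recovered from its Moreau envelope: the lower bound
`m t ≥ moreauEnvelope m u - (u - t)² / 2` is attained at `u = t + g`, `g` a subgradient at `t`,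
and it is only lost quadratically away from that point. -/
theorem le_moreauEnvelope_of_subgradient {t g : ℝ} (hg : ∀ s, m t + g * (s - t) ≤ m s) (u : ℝ) :
    m t - (u - t - g) ^ 2 / 2 ≤ moreauEnvelope m u - (u - t) ^ 2 / 2 := by
  rw [le_sub_iff_add_le]
  refine le_ciInf fun s => ?_
  nlinarith [hg s, sq_nonneg (u - s - g)]

theorem abs_moreauEnvelope_le (hc : ConvexOn ℝ Set.univ m) (hl : LipschitzWith L m) (u : ℝ) :
    |moreauEnvelope m u| ≤ |m 0| + L * |u| + L ^ 2 / 2 := by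
  obtain ⟨g, hgL, hg⟩ := exists_subgradient hc hl u
  have h1 := moreauEnvelope_le hc hl u u
  have h2 := le_moreauEnvelope_of_subgradient hg u
  have h3 : g ^ 2 ≤ (L : ℝ) ^ 2 := sq_le_sq' (abs_le.1 hgL).1 (abs_le.1 hgL).2
  have h4 := hl.dist_le_mul u 0
  rw [Real.dist_eq, Real.dist_eq, sub_zero] at h4
  have h5 := abs_le.1 h4
  have h6 := abs_le.1 (le_refl |m 0|)
  simp at h1 h2
  rw [abs_le]
  constructor <;> nlinarith

/-- The Moreau envelope is convex and `u ↦ u² / 2` minus the envelope is convex too, so its second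
differences of step `h` lie in `[0, h²]`. -/
theorem moreauEnvelope_second_diff (hc : ConvexOn ℝ Set.univ m) (hl : LipschitzWith L m)
    (u h : ℝ) :
    0 ≤ moreauEnvelope m (u + h) - 2 * moreauEnvelope m u + moreauEnvelope m (u - h) ∧
    moreauEnvelope m (u + h) - 2 * moreauEnvelope m u + moreauEnvelope m (u - h) ≤ h ^ 2 := by
  have key : ∀ v e, 0 < e → ∃ s, m s + (v - s) ^ 2 / 2 < moreauEnvelope m v + e := fun v e he =>
    exists_lt_of_ciInf_lt (lt_add_of_pos_right _ he)
  constructor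
  · refine le_of_forall_pos_le_add fun e he => ?_
    obtain ⟨s, hs⟩ := key (u + h) (e / 2) (by positivity)
    obtain ⟨t, ht⟩ := key (u - h) (e / 2) (by positivity)
    have h1 := moreauEnvelope_le hc hl u ((1 / 2 : ℝ) • s + (1 / 2 : ℝ) • t)
    have h2 := hc.2 (Set.mem_univ s) (Set.mem_univ t)
      (show (0 : ℝ) ≤ 1 / 2 by norm_num) (show (0 : ℝ) ≤ 1 / 2 by norm_num) (by norm_num)
    simp only [smul_eq_mul] at h1 h2
    nlinarith [sq_nonneg ((u + h - s) - (u - h - t))]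
  · refine le_of_forall_pos_le_add fun e he => ?_
    obtain ⟨s, hs⟩ := key u (e / 2) (by positivity)
    have h1 := moreauEnvelope_le hc hl (u + h) s
    have h2 := moreauEnvelope_le hc hl (u - h) s
    nlinarith

end Moreau

/-! ### Entropy of convex Lipschitz functions and of single index functions -/

/-- The integer sequence with given first two terms and given second differences. -/
def ofSecondDiff (a₀ a₁ : ℤ) (e : ℕ → ℤ) : ℕ → ℤ
  | 0 => a₀
  | 1 => a₁
  | j + 2 => 2 * ofSecondDiff a₀ a₁ e (j + 1) - ofSecondDiff a₀ a₁ e j + e j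

theorem ofSecondDiff_eq (a : ℕ → ℤ) (e : ℕ → ℤ) (K : ℕ)
    (he : ∀ j < K, e j = a (j + 2) - 2 * a (j + 1) + a j) :
    ∀ j, j ≤ K + 1 → ofSecondDiff (a 0) (a 1) e j = a j
  | 0, _ => by simp [ofSecondDiff]
  | 1, _ => by simp [ofSecondDiff]
  | j + 2, hj => by
    rw [ofSecondDiff, ofSecondDiff_eq a e K he (j + 1) (by omega),
      ofSecondDiff_eq a e K he j (by omega), he j (by omega)]
    ring

/-- The number of integers `a` with `|a| ≤ Q / h²`, up to rounding, is at most `exp (C / h)`. -/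
theorem card_Icc_le_exp {Q h : ℝ} (hQ : 0 ≤ Q) (h0 : 0 < h) (h1 : h ≤ 1) (N : ℕ)
    (hN : N = ⌈Q / h ^ 2⌉₊ + 1) :
    (Fintype.card (Finset.Icc (-N : ℤ) N) : ℝ) ≤ Real.exp ((2 * Q + 7) / h) := by
  have e1 : (Fintype.card (Finset.Icc (-N : ℤ) N) : ℝ) = 2 * N + 1 := by
    rw [Fintype.card_coe, Int.card_Icc]
    have : ((N : ℤ) + 1 - -N).toNat = 2 * N + 1 := by omega
    rw [this]; push_cast; ring
  have e2 : (N : ℝ) ≤ Q / h ^ 2 + 2 := by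
    rw [hN]; push_cast
    linarith [(Nat.ceil_lt_add_one (show 0 ≤ Q / h ^ 2 by positivity)).le]
  have hx : 1 ≤ 1 / h := by rw [le_div_iff₀ h0]; linarith
  have e3 : (2 * N + 1 : ℝ) ≤ (2 * Q + 5) * (1 / h) ^ 2 := by
    have : Q / h ^ 2 = Q * (1 / h) ^ 2 := by field_simp
    nlinarith [one_le_pow₀ (n := 2) hx]
  rw [e1]
  refine e3.trans ?_
  have e4 : (1 / h) ^ 2 ≤ Real.exp (2 * (1 / h)) := by
    rw [two_mul, Real.exp_add, sq]
    have : 1 / h ≤ Real.exp (1 / h) := by linarith [Real.add_one_le_exp (1 / h)]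
    exact mul_le_mul this this (by positivity) (Real.exp_pos _).le
  have e5 : 2 * Q + 5 ≤ Real.exp (2 * Q + 5) := by linarith [Real.add_one_le_exp (2 * Q + 5)]
  calc (2 * Q + 5) * (1 / h) ^ 2 ≤ Real.exp (2 * Q + 5) * Real.exp (2 * (1 / h)) :=
        mul_le_mul e5 e4 (by positivity) (Real.exp_pos _).le
    _ = Real.exp (2 * Q + 5 + 2 * (1 / h)) := (Real.exp_add _ _).symm
    _ ≤ _ := by
      rw [Real.exp_le_exp, show (2 * Q + 7) / h = (2 * Q + 5) * (1 / h) + 2 * (1 / h) by ring]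
      nlinarith

theorem mem_Icc_ceil {x Q : ℝ} (hx : |x| ≤ Q) (N : ℕ) (hN : N = ⌈Q⌉₊ + 1) :
    ⌊x⌋ ∈ Finset.Icc (-N : ℤ) N := by
  have h1 := abs_le.1 hx
  have h2 := Nat.le_ceil Q
  have h3 : (N : ℝ) = ⌈Q⌉₊ + 1 := by rw [hN]; push_cast; ring
  rw [Finset.mem_Icc]
  refine ⟨Int.le_floor.2 ?_, Int.cast_le (R := ℝ).1 ((Int.floor_le x).trans ?_)⟩
  · push_cast; linarith
  · push_cast; linarith

/-- Sup-norm entropy of uniformly Lipschitz convex functions on `[-R, R]`: nets at scale `h²` of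
cardinality `exp (C / h)`. Because a convex function is recovered, without loss in the sup norm,
from its Moreau envelope, it is enough to record the envelope on a grid of step `h` up to an error
of order `h²`. Its rounded second differences take boundedly many values, so a bounded number
of choices per grid point is enough. -/
theorem exists_net_convex_lipschitz (L : ℝ≥0) {B R : ℝ} (hB : 0 ≤ B) (hR : 0 ≤ R) :
    ∃ C : ℝ, ∀ h : ℝ, 0 < h → h ≤ 1 → ∃ (ι : Type) (_ : Fintype ι) (F : ι → ℝ → ℝ),
      (Fintype.card ι : ℝ) ≤ Real.exp (C / h) ∧ (∀ i, Continuous (F i)) ∧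
      ∀ m : ℝ → ℝ, ConvexOn ℝ Set.univ m → LipschitzWith L m → |m 0| ≤ B →
        ∃ i, ∀ t, |t| ≤ R → |m t - F i t| ≤ h ^ 2 := by
  have hL : (0 : ℝ) ≤ L := L.coe_nonneg
  -- `m t` is recovered from the envelope at `t + g` with `|g| ≤ L`, so a grid on `[-S, S]` serves
  -- all `t` in `[-R, R]`
  obtain ⟨S, hS⟩ : ∃ S : ℝ, S = R + L := ⟨_, rfl⟩
  have hS0 : 0 ≤ S := by linarith
  obtain ⟨Q, hQ⟩ : ∃ Q : ℝ, Q = 2 * (B + L * (S + 1) + L ^ 2 / 2) := ⟨_, rfl⟩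
  have hQ0 : 0 ≤ Q := by rw [hQ]; positivity
  refine ⟨2 * (2 * Q + 7) + 7 * (2 * S + 1), fun h h0 h1 => ?_⟩
  obtain ⟨N, hN⟩ : ∃ N : ℕ, N = ⌈Q / h ^ 2⌉₊ + 1 := ⟨_, rfl⟩
  obtain ⟨K, hK⟩ : ∃ K : ℕ, K = ⌈2 * S / h⌉₊ := ⟨_, rfl⟩
  have hKle : (K : ℝ) ≤ (2 * S + 1) / h := by
    rw [hK, add_div]
    have : 1 ≤ 1 / h := by rw [le_div_iff₀ h0]; linarith
    linarith [(Nat.ceil_lt_add_one (show 0 ≤ 2 * S / h by positivity)).le]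
  let ext : (Fin K → Finset.Icc (-2 : ℤ) 4) → ℕ → ℤ := fun e j =>
    if hj : j < K then (e ⟨j, hj⟩ : ℤ) else 0
  refine ⟨Finset.Icc (-N : ℤ) N × Finset.Icc (-N : ℤ) N × (Fin K → Finset.Icc (-2 : ℤ) 4),
    inferInstance, fun i t => (Finset.range (K + 1)).sup' ⟨0, by simp⟩ fun j =>
      h ^ 2 / 2 * (ofSecondDiff i.1 i.2.1 (ext i.2.2) j : ℝ) - (-S + j * h - t) ^ 2 / 2,
    ?_, ?_, ?_⟩
  · rw [Fintype.card_prod, Fintype.card_prod, Fintype.card_fun, Fintype.card_fin]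
    push_cast
    have e1 := card_Icc_le_exp hQ0 h0 h1 N hN
    have e2 : ((Fintype.card (Finset.Icc (-2 : ℤ) 4) : ℕ) : ℝ) ^ K
        ≤ Real.exp (7 * ((2 * S + 1) / h)) := by
      have : ((Fintype.card (Finset.Icc (-2 : ℤ) 4) : ℕ) : ℝ) = 7 := by
        rw [Fintype.card_coe]; rfl
      rw [this]
      calc (7 : ℝ) ^ K ≤ Real.exp 7 ^ K := by
            gcongr; linarith [Real.add_one_le_exp 7]
        _ = Real.exp (K * 7) := (Real.exp_nat_mul _ _).symm
        _ ≤ _ := by rw [Real.exp_le_exp]; linarith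
    calc _ ≤ Real.exp ((2 * Q + 7) / h) * (Real.exp ((2 * Q + 7) / h)
          * Real.exp (7 * ((2 * S + 1) / h))) := by gcongr
      _ = _ := by rw [← Real.exp_add, ← Real.exp_add]; congr 1; ring
  · intro i
    refine Continuous.finset_sup'_apply _ fun j _ => ?_
    fun_prop
  · intro m hc hl hm0
    have hh : (0 : ℝ) < h ^ 2 := by positivity
    obtain ⟨M, hM⟩ : ∃ M : ℕ → ℝ, M = fun j : ℕ => moreauEnvelope m (-S + j * h) := ⟨_, rfl⟩
    -- the envelope at the grid points, rounded down to multiples of `h² / 2`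
    obtain ⟨a, ha⟩ : ∃ a : ℕ → ℤ, a = fun j => ⌊2 * M j / h ^ 2⌋ := ⟨_, rfl⟩
    have ha1 : ∀ j, h ^ 2 / 2 * (a j : ℝ) ≤ M j := fun j => by
      have := Int.floor_le (2 * M j / h ^ 2)
      rw [le_div_iff₀ hh] at this
      rw [ha]; simp only; linarith
    have ha2 : ∀ j, M j ≤ h ^ 2 / 2 * (a j : ℝ) + h ^ 2 / 2 := fun j => by
      have := (Int.lt_floor_add_one (2 * M j / h ^ 2)).le
      rw [div_le_iff₀ hh] at this
      rw [ha]; simp only; linarith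
    have hfirst : ∀ j : ℕ, j ≤ 1 → a j ∈ Finset.Icc (-N : ℤ) N := fun j hj => by
      rw [ha]
      refine mem_Icc_ceil ?_ N hN
      rw [abs_div, abs_of_pos hh, abs_mul, abs_two]
      gcongr
      rw [hQ, hM]
      have e1 := abs_moreauEnvelope_le hc hl (-S + j * h)
      have e2 : |-S + j * h| ≤ S + 1 := by
        have : (j : ℝ) * h ≤ 1 := by
          have : (j : ℝ) ≤ 1 := by exact_mod_cast hj
          nlinarith
        have : 0 ≤ (j : ℝ) * h := by positivity
        rw [abs_le]; constructor <;> linarith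
      have e3 := mul_le_mul_of_nonneg_left e2 hL
      simp only
      linarith
    have hdiff : ∀ j, a (j + 2) - 2 * a (j + 1) + a j ∈ Finset.Icc (-2 : ℤ) 4 := fun j => by
      have e := moreauEnvelope_second_diff hc hl (-S + (j + 1 : ℕ) * h) h
      have e1 : moreauEnvelope m (-S + (j + 1 : ℕ) * h + h) = M (j + 2) := by
        rw [hM]; push_cast; congr 1; ring
      have e2 : moreauEnvelope m (-S + (j + 1 : ℕ) * h - h) = M j := by
        rw [hM]; push_cast; congr 1; ring
      have e3 : moreauEnvelope m (-S + (j + 1 : ℕ) * h) = M (j + 1) := by rw [hM]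
      rw [e1, e2, e3] at e
      have := ha1 j; have := ha1 (j + 1); have := ha1 (j + 2)
      have := ha2 j; have := ha2 (j + 1); have := ha2 (j + 2)
      rw [Finset.mem_Icc]
      constructor
      · have : (-2 : ℝ) ≤ a (j + 2) - 2 * a (j + 1) + a j := by
          refine le_of_mul_le_mul_left ?_ (half_pos hh); linarith
        exact_mod_cast this
      · have : (a (j + 2) - 2 * a (j + 1) + a j : ℝ) ≤ 4 := by
          refine le_of_mul_le_mul_left ?_ (half_pos hh); linarith
        exact_mod_cast this
    refine ⟨(⟨a 0, hfirst 0 (by norm_num)⟩, ⟨a 1, hfirst 1 le_rfl⟩,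
      fun j => ⟨_, hdiff j⟩), fun t ht => ?_⟩
    have hrec : ∀ j ∈ Finset.range (K + 1), ofSecondDiff (a 0) (a 1)
        (ext fun j => ⟨_, hdiff j⟩) j = a j := fun j hj => by
      refine ofSecondDiff_eq a _ K (fun j hj => ?_) j (by simp at hj; omega)
      simp [ext, hj]
    have hle : (Finset.range (K + 1)).sup' ⟨0, by simp⟩ (fun j =>
        h ^ 2 / 2 * (ofSecondDiff (a 0) (a 1) (ext fun j => ⟨_, hdiff j⟩) j : ℝ)
          - (-S + j * h - t) ^ 2 / 2) ≤ m t := by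
      refine Finset.sup'_le _ _ fun j hj => ?_
      rw [hrec j hj]
      have e1 := moreauEnvelope_le hc hl (-S + j * h) t
      have e2 := ha1 j
      rw [hM] at e2
      simp only at e2
      linarith
    -- the grid point next to `t + g` almost attains the supremum that recovers `m t`
    have hge : m t - h ^ 2 ≤ (Finset.range (K + 1)).sup' ⟨0, by simp⟩ (fun j =>
        h ^ 2 / 2 * (ofSecondDiff (a 0) (a 1) (ext fun j => ⟨_, hdiff j⟩) j : ℝ)
          - (-S + j * h - t) ^ 2 / 2) := by
      obtain ⟨g, hgL, hg⟩ := exists_subgradient hc hl t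
      have ht' := abs_le.1 ht
      have hg' := abs_le.1 hgL
      have hx0 : 0 ≤ (t + g + S) / h := by
        apply div_nonneg _ h0.le; linarith
      have hj : ⌊(t + g + S) / h⌋₊ ∈ Finset.range (K + 1) := by
        rw [Finset.mem_range, Nat.lt_succ_iff, hK]
        refine (Nat.floor_mono ?_).trans (Nat.floor_le_ceil _)
        gcongr; linarith
      refine le_trans ?_ (Finset.le_sup' _ hj)
      rw [hrec _ hj]
      have f1 := Nat.floor_le hx0
      have f2 := (Nat.lt_floor_add_one ((t + g + S) / h)).le
      rw [le_div_iff₀ h0] at f1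
      rw [div_le_iff₀ h0] at f2
      obtain ⟨j, hjeq⟩ : ∃ j : ℕ, j = ⌊(t + g + S) / h⌋₊ := ⟨_, rfl⟩
      rw [← hjeq] at f1 f2 ⊢
      have e1 := le_moreauEnvelope_of_subgradient hg (-S + j * h)
      have e2 := ha2 j
      rw [hM] at e2
      simp only at e2
      have e3 : (-S + j * h - t - g) ^ 2 ≤ h ^ 2 := sq_le_sq' (by linarith) (by linarith)
      linarith
    rw [abs_le]
    constructor <;> linarith

/-- Nets of the parameter space: rounding the coordinates gives cardinality polynomial in `1 / h`,
hence at most `exp (C / h)`. -/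
theorem exists_net_paramSpace (d : ℕ) [NeZero d] (hne : (paramSpace d).Nonempty) :
    ∃ C : ℝ, ∀ h : ℝ, 0 < h → h ≤ 1 →
      ∃ (ι : Type) (_ : Fintype ι) (T : ι → EuclideanSpace ℝ (Fin d)),
      (Fintype.card ι : ℝ) ≤ Real.exp (C / h) ∧ (∀ i, T i ∈ paramSpace d) ∧
      ∀ θ ∈ paramSpace d, ∃ i, ‖θ - T i‖ ≤ h ^ 2 := by
  classical
  refine ⟨d * (2 * d + 7), fun h h0 h1 => ?_⟩
  have hd : (0 : ℝ) < d := by exact_mod_cast Nat.pos_of_ne_zero (NeZero.ne d)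
  have hh : (0 : ℝ) < h ^ 2 := by positivity
  obtain ⟨N, hN⟩ : ∃ N : ℕ, N = ⌈(d : ℝ) / h ^ 2⌉₊ + 1 := ⟨_, rfl⟩
  have hmem : ∀ θ ∈ paramSpace d, ∀ j, ⌊θ j * (d / h ^ 2)⌋ ∈ Finset.Icc (-N : ℤ) N := by
    intro θ hθ j
    refine mem_Icc_ceil ?_ N hN
    have : |θ j| ≤ 1 := by
      have := PiLp.norm_apply_le θ j
      rwa [hθ.1] at this
    rw [abs_mul, abs_of_pos (show 0 < (d : ℝ) / h ^ 2 by positivity)]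
    exact mul_le_of_le_one_left (by positivity) this
  obtain ⟨θ₁, hθ₁⟩ := hne
  let T : (Fin d → Finset.Icc (-N : ℤ) N) → EuclideanSpace ℝ (Fin d) := fun c =>
    if hc : ∃ θ ∈ paramSpace d, ∀ j, ⌊θ j * (d / h ^ 2)⌋ = c j then hc.choose else θ₁
  refine ⟨Fin d → Finset.Icc (-N : ℤ) N, inferInstance, T, ?_, ?_, ?_⟩
  · rw [Fintype.card_fun, Fintype.card_fin]
    push_cast
    calc _ ≤ Real.exp ((2 * d + 7) / h) ^ d := by
          gcongr; exact card_Icc_le_exp hd.le h0 h1 N hN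
      _ = _ := by rw [← Real.exp_nat_mul]; congr 1; ring
  · intro c
    simp only [T]
    split_ifs with hc
    · exact hc.choose_spec.1
    · exact hθ₁
  · intro θ hθ
    refine ⟨fun j => ⟨_, hmem θ hθ j⟩, ?_⟩
    have hc : ∃ θ' ∈ paramSpace d, ∀ j, ⌊θ' j * (d / h ^ 2)⌋ = ⌊θ j * (d / h ^ 2)⌋ :=
      ⟨θ, hθ, fun _ => rfl⟩
    simp only [T]
    rw [dif_pos hc]
    have hspec := hc.choose_spec.2
    set θ' := hc.choose
    have hcoord : ∀ j, |θ j - θ' j| ≤ h ^ 2 / d := fun j => by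
      have e := (Int.abs_sub_lt_one_of_floor_eq_floor (hspec j)).le
      rw [← sub_mul, abs_mul, abs_of_pos (show 0 < (d : ℝ) / h ^ 2 by positivity),
        abs_sub_comm] at e
      rw [le_div_iff₀ hd]
      rw [mul_div_assoc', div_le_iff₀ hh, one_mul] at e
      exact e
    rw [EuclideanSpace.norm_eq]
    apply Real.sqrt_le_iff.2 ⟨hh.le, ?_⟩
    calc ∑ j, ‖(θ - θ') j‖ ^ 2 ≤ ∑ _j : Fin d, (h ^ 2 / d) ^ 2 := by
          gcongr with j; exact hcoord j
      _ = (h ^ 2) ^ 2 / d := by simp; field_simp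
      _ ≤ (h ^ 2) ^ 2 := by
        apply div_le_self (by positivity)
        exact_mod_cast Nat.pos_of_ne_zero (NeZero.ne d)

/-- Sup-norm entropy of the single index class `{x ↦ m (θᵀx)}` on a bounded set. -/
theorem exists_net_singleIndex (d : ℕ) [NeZero d] (hne : (paramSpace d).Nonempty) (L : ℝ≥0)
    {B R : ℝ} (hB : 0 ≤ B) (hR : 0 ≤ R) :
    ∃ C : ℝ, 0 < C ∧ ∀ h : ℝ, 0 < h → h ≤ 1 →
      ∃ (ι : Type) (_ : Fintype ι) (F : ι → EuclideanSpace ℝ (Fin d) → ℝ),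
      (Fintype.card ι : ℝ) ≤ Real.exp (C / h) ∧ (∀ i, Continuous (F i)) ∧
      ∀ m : ℝ → ℝ, ConvexOn ℝ Set.univ m → LipschitzWith L m → |m 0| ≤ B →
        ∀ θ ∈ paramSpace d, ∃ i, ∀ x, ‖x‖ ≤ R → |m (inner ℝ θ x) - F i x| ≤ h ^ 2 := by
  obtain ⟨C₁, hC₁⟩ := exists_net_convex_lipschitz L hB hR
  obtain ⟨C₂, hC₂⟩ := exists_net_paramSpace d hne
  -- half of the error budget goes to each net: the scale `h` is shrunk by a factor `a`
  obtain ⟨a, ha⟩ : ∃ a : ℝ, a = 2 * (1 + L * R) := ⟨_, rfl⟩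
  have hLR : 0 ≤ (L : ℝ) * R := mul_nonneg L.coe_nonneg hR
  have ha1 : 2 ≤ a := by linarith
  refine ⟨a * (|C₁| + |C₂|) + 1, by positivity, fun h h0 h1 => ?_⟩
  have hs0 : 0 < h / a := by positivity
  have hs1 : h / a ≤ 1 := by rw [div_le_one (by linarith)]; linarith
  obtain ⟨ι₁, _, F, hF1, hF2, hF3⟩ := hC₁ (h / a) hs0 hs1
  obtain ⟨ι₂, _, T, hT1, hT2, hT3⟩ := hC₂ (h / a) hs0 hs1
  refine ⟨ι₁ × ι₂, inferInstance, fun i x => F i.1 (inner ℝ (T i.2) x), ?_, ?_, ?_⟩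
  · rw [Fintype.card_prod]
    push_cast
    calc _ ≤ Real.exp (C₁ / (h / a)) * Real.exp (C₂ / (h / a)) := by gcongr
      _ = Real.exp (a * (C₁ + C₂) / h) := by
        rw [← Real.exp_add]; congr 1; field_simp
      _ ≤ _ := by
        gcongr
        nlinarith [le_abs_self C₁, le_abs_self C₂]
  · intro i
    exact (hF2 i.1).comp (by fun_prop)
  · intro m hc hl hm θ hθ
    obtain ⟨i, hi⟩ := hF3 m hc hl hm
    obtain ⟨j, hj⟩ := hT3 θ hθ
    refine ⟨(i, j), fun x hx => ?_⟩
    have e1 : |inner ℝ (T j) x| ≤ R := by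
      refine (abs_real_inner_le_norm _ _).trans ?_
      rw [(hT2 j).1, one_mul]; exact hx
    have e2 := hi _ e1
    have e3 : |m (inner ℝ θ x) - m (inner ℝ (T j) x)| ≤ L * R * (h / a) ^ 2 := by
      have := hl.dist_le_mul (inner ℝ θ x) (inner ℝ (T j) x)
      rw [Real.dist_eq, Real.dist_eq, ← inner_sub_left] at this
      refine this.trans ?_
      rw [mul_assoc]
      gcongr
      refine (abs_real_inner_le_norm _ _).trans ?_
      rw [mul_comm]
      gcongr
    have e4 := abs_sub_le (m (inner ℝ θ x)) (m (inner ℝ (T j) x)) (F i (inner ℝ (T j) x))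
    have e5 : (1 + L * R) * (h / a) ^ 2 ≤ h ^ 2 := by
      rw [div_pow, mul_div_assoc', div_le_iff₀ (by positivity)]
      rw [show 1 + L * R = a / 2 by linarith, mul_comm]
      have : a / 2 ≤ a ^ 2 := by nlinarith
      gcongr
    simp only
    linarith

/-! ### The law of the index and differentiation of identities -/

section Index

variable {Ω : Type*} [MeasurableSpace Ω] {P : Measure Ω} {d : ℕ} [NeZero d]
  {X : Ω → EuclideanSpace ℝ (Fin d)}

/-- A measurable set that meets every line parallel to the first coordinate axis in a
Lebesgue null set is null for the law of the covariate: fix one of the countably many values of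
the discrete coordinates and use Fubini for the density of the others. -/
theorem ae_notMem_of_ae_lines (hX : Measurable X) {d₁ : ℕ} (hd₁ : 1 ≤ d₁)
    (hcont : ContinuousDiscrete P X d₁) {N : Set (EuclideanSpace ℝ (Fin d))}
    (hN : MeasurableSet N)
    (hline : ∀ x, ∀ᵐ s : ℝ, x + s • EuclideanSpace.single (0 : Fin d) (1 : ℝ) ∉ N) :
    ∀ᵐ x ∂(P.map X), x ∉ N := by
  classical
  obtain ⟨hac, hdisc⟩ := hcont
  let glue : ({j : Fin d // ¬ (j : ℕ) < d₁} → ℝ) → ({j : Fin d // (j : ℕ) < d₁} → ℝ) →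
      EuclideanSpace ℝ (Fin d) := fun c h => WithLp.toLp 2 fun j =>
    if hj : (j : ℕ) < d₁ then h ⟨j, hj⟩ else c ⟨j, hj⟩
  have hglue : ∀ c, Measurable (glue c) := fun c => by
    refine (WithLp.measurable_toLp 2 _).comp (measurable_pi_lambda _ fun j => ?_)
    by_cases hj : (j : ℕ) < d₁
    · simp only [hj, dif_pos]; exact measurable_pi_apply _
    · simp only [hj, dif_neg, not_false_iff]; exact measurable_const
  have hzero : ((0 : Fin d) : ℕ) < d₁ := by simpa using Nat.lt_of_succ_le hd₁
  have hslice : ∀ c, ∀ᵐ h : {j : Fin d // (j : ℕ) < d₁} → ℝ, h ∈ (glue c ⁻¹' N)ᶜ := fun c => by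
    refine ae_mem_of_ae_add_linearMap_mem (𝕜 := ℝ)
      (LinearMap.single ℝ (fun _ : {j : Fin d // (j : ℕ) < d₁} => ℝ) ⟨0, hzero⟩)
      (volume : Measure ℝ) volume (hglue c hN).compl fun h => ?_
    filter_upwards [hline (glue c h)] with s hs
    have : glue c (h + LinearMap.single ℝ (fun _ : {j : Fin d // (j : ℕ) < d₁} => ℝ)
        ⟨0, hzero⟩ s) = glue c h + s • EuclideanSpace.single (0 : Fin d) (1 : ℝ) := by
      ext j
      by_cases hj : (j : ℕ) < d₁
      · by_cases hj0 : j = 0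
        · subst hj0; simp [glue, Nat.lt_of_succ_le hd₁]
        · have : (⟨j, hj⟩ : {j : Fin d // (j : ℕ) < d₁}) ≠ ⟨0, hzero⟩ := by simpa using hj0
          simp [glue, hj, hj0]
      · have hj0 : j ≠ 0 := by rintro rfl; exact hj hzero
        simp [glue, hj, hj0]
    rwa [Set.mem_compl_iff, Set.mem_preimage, this]
  have hmeas : Measurable fun ω (j : {j : Fin d // (j : ℕ) < d₁}) => X ω j :=
    measurable_pi_lambda _ fun j => by fun_prop
  have hS : ∀ j : {j : Fin d // ¬ (j : ℕ) < d₁}, ∃ S : Set ℝ, S.Countable ∧ ∀ᵐ ω ∂P, X ω j ∈ S :=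
    fun j => hdisc j (not_lt.1 j.2)
  choose S hSc hSae using hS
  have hcount : (Set.univ.pi S).Countable := Set.countable_univ_pi hSc
  rw [ae_map_iff hX.aemeasurable hN.compl]
  have h1 : ∀ᵐ ω ∂P, ∀ c ∈ Set.univ.pi S, (fun j : {j : Fin d // (j : ℕ) < d₁} => X ω j)
      ∈ (glue c ⁻¹' N)ᶜ :=
    (ae_ball_iff hcount).2 fun c _ => ae_of_ae_map hmeas.aemeasurable (hac.ae_le (hslice c))
  filter_upwards [h1, ae_all_iff.2 hSae] with ω hω hω'
  have := hω (fun j => X ω j) fun j _ => hω' j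
  rw [Set.mem_compl_iff, Set.mem_preimage] at this
  convert this using 2
  ext j
  by_cases hj : (j : ℕ) < d₁ <;> simp [glue, hj]

theorem inner_add_smul_single (θ x : EuclideanSpace ℝ (Fin d)) (s : ℝ) :
    inner ℝ θ (x + s • EuclideanSpace.single (0 : Fin d) (1 : ℝ)) = inner ℝ θ x + s * θ 0 := by
  rw [inner_add_right, inner_smul_right, EuclideanSpace.inner_single_right]
  simp

/-- The law of `θᵀX` is absolutely continuous when `θ 0 ≠ 0`. -/
theorem ae_inner_of_ae_volume (hX : Measurable X) {d₁ : ℕ} (hd₁ : 1 ≤ d₁)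
    (hcont : ContinuousDiscrete P X d₁) {θ : EuclideanSpace ℝ (Fin d)} (hθ : θ 0 ≠ 0)
    {p : ℝ → Prop} (hp : ∀ᵐ t : ℝ, p t) : ∀ᵐ x ∂(P.map X), p (inner ℝ θ x) := by
  obtain ⟨A, hA, hAm, hA0⟩ := exists_measurable_superset_of_null (ae_iff.1 hp)
  have hN : MeasurableSet {x : EuclideanSpace ℝ (Fin d) | inner ℝ θ x ∈ A} :=
    hAm.preimage (by fun_prop)
  refine (ae_notMem_of_ae_lines hX hd₁ hcont hN fun x => ?_).mono fun x hx => ?_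
  · have h1 : (fun s : ℝ => inner ℝ θ x + s * θ 0) ⁻¹' A =
        (fun s : ℝ => s * θ 0) ⁻¹' ((fun s => inner ℝ θ x + s) ⁻¹' A) := rfl
    have h2 : volume ((fun s : ℝ => inner ℝ θ x + s * θ 0) ⁻¹' A) = 0 := by
      rw [h1, Real.volume_preimage_mul_right hθ, measure_preimage_add, hA0, mul_zero]
    rw [ae_iff]
    refine measure_mono_null (fun s hs => ?_) h2
    simpa [inner_add_smul_single] using hs
  · by_contra h
    exact hx (hA h)

/-- If `m (θᵀx) = m₀ (θ₀ᵀx)` almost everywhere, then this identity may be differentiated along the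
first coordinate: on each line the zeros of the difference at which its derivative does not vanish
are isolated, hence null. -/
theorem ae_deriv_eq_of_ae_eq (hX : Measurable X) {d₁ : ℕ} (hd₁ : 1 ≤ d₁)
    (hcont : ContinuousDiscrete P X d₁) {m m₀ : ℝ → ℝ} {L L₀ : ℝ≥0} (hm : LipschitzWith L m)
    (hm₀ : LipschitzWith L₀ m₀) {θ θ₀ : EuclideanSpace ℝ (Fin d)}
    (h : ∀ᵐ x ∂(P.map X), m (inner ℝ θ x) = m₀ (inner ℝ θ₀ x)) :
    ∀ᵐ x ∂(P.map X), θ 0 * deriv m (inner ℝ θ x) = θ₀ 0 * deriv m₀ (inner ℝ θ₀ x) := by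
  set e : EuclideanSpace ℝ (Fin d) := EuclideanSpace.single (0 : Fin d) (1 : ℝ) with he
  set F : EuclideanSpace ℝ (Fin d) → ℝ := fun x => m (inner ℝ θ x) - m₀ (inner ℝ θ₀ x) with hF
  have hFc : Continuous F :=
    (hm.continuous.comp (by fun_prop)).sub (hm₀.continuous.comp (by fun_prop))
  have hN : MeasurableSet {x | F x = 0 ∧ lineDeriv ℝ F x e ≠ 0} :=
    (hFc.measurable (measurableSet_singleton 0)).inter
      ((measurable_lineDeriv hFc) (measurableSet_singleton 0).compl)
  have hnull := ae_notMem_of_ae_lines hX hd₁ hcont hN fun x => by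
    rw [ae_iff]
    simp only [not_not]
    refine measure_null_of_locally_null _ fun s hs => ⟨{s}, ?_, by simp⟩
    obtain ⟨-, hs2⟩ := hs
    have hd : HasDerivAt (fun t => F (x + t • e)) (lineDeriv ℝ F (x + s • e) e) s := by
      have h1 : HasLineDerivAt ℝ F (lineDeriv ℝ F (x + s • e) e) (x + s • e) e := by
        by_contra hcon
        exact hs2 (lineDeriv_zero_of_not_lineDifferentiableAt fun hdiff =>
          hcon hdiff.hasLineDerivAt)
      have h2 : HasDerivAt (fun t => F (x + s • e + t • e)) (lineDeriv ℝ F (x + s • e) e)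
          (s - s) := by rw [sub_self]; exact h1
      have h3 := h2.comp_sub_const s s
      refine h3.congr_of_eventuallyEq (Eventually.of_forall fun t => ?_)
      simp only
      congr 1
      rw [add_assoc, ← add_smul]; congr 2; ring
    have hev := hd.eventually_ne (c := 0) hs2
    rw [mem_nhdsWithin_iff_eventually]
    rw [eventually_nhdsWithin_iff] at hev
    filter_upwards [hev] with t ht htS
    by_contra hts
    exact ht hts htS.1
  have hline : ∀ (m : ℝ → ℝ) (θ x : EuclideanSpace ℝ (Fin d)),
      (θ 0 ≠ 0 → DifferentiableAt ℝ m (inner ℝ θ x)) →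
      HasLineDerivAt ℝ (fun x => m (inner ℝ θ x)) (θ 0 * deriv m (inner ℝ θ x)) x e := by
    intro m θ x hd
    rw [HasLineDerivAt]
    simp only [he, inner_add_smul_single]
    by_cases h0 : θ 0 = 0
    · simpa [h0] using hasDerivAt_const (0 : ℝ) (m (inner ℝ θ x))
    · have h1 : HasDerivAt (fun t : ℝ => inner ℝ θ x + t * θ 0) (θ 0) 0 := by
        simpa using ((hasDerivAt_id (0 : ℝ)).mul_const (θ 0)).const_add (inner ℝ θ x)
      have h2 : HasDerivAt m (deriv m (inner ℝ θ x)) (inner ℝ θ x + 0 * θ 0) := by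
        simpa using (hd h0).hasDerivAt
      have := h2.comp (0 : ℝ) h1
      rw [mul_comm]
      exact this
  have hdiff : ∀ {m : ℝ → ℝ} {L : ℝ≥0}, LipschitzWith L m → ∀ θ : EuclideanSpace ℝ (Fin d),
      ∀ᵐ x ∂(P.map X), θ 0 ≠ 0 → DifferentiableAt ℝ m (inner ℝ θ x) := by
    intro m L hm θ
    by_cases h0 : θ 0 = 0
    · exact Eventually.of_forall fun x hx => absurd h0 hx
    · exact (ae_inner_of_ae_volume hX hd₁ hcont h0 hm.ae_differentiableAt).mono fun x hx _ => hx
  filter_upwards [h, hnull, hdiff hm θ, hdiff hm₀ θ₀] with x h1 h2 h3 h4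
  have h5 : lineDeriv ℝ F x e = 0 := by
    by_contra hcon
    exact h2 ⟨by simp [hF, h1], hcon⟩
  have h6 : HasLineDerivAt ℝ F (θ 0 * deriv m (inner ℝ θ x) - θ₀ 0 * deriv m₀ (inner ℝ θ₀ x)) x e :=
    HasDerivAt.sub (hline m θ x h3) (hline m₀ θ₀ x h4)
  rw [h6.lineDeriv] at h5
  linarith

end Index

/-- Nondegeneracy in use: if, off a null set, two covariate values with the same index `t` and
`ρ t ≠ 0` agree in the direction `v`, then `ρ` vanishes almost everywhere. -/
theorem NondegenerateGivenIndex.ae_eq_zero {Ω : Type*} [MeasurableSpace Ω] {P : Measure Ω}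
    [IsFiniteMeasure P] {d : ℕ} {X : Ω → EuclideanSpace ℝ (Fin d)} (hX : Measurable X)
    {θ₀ v : EuclideanSpace ℝ (Fin d)} (hnd : NondegenerateGivenIndex P X θ₀)
    (hv : ∀ c : ℝ, v ≠ c • θ₀) {Q : EuclideanSpace ℝ (Fin d) → Prop}
    (hQ : ∀ᵐ x ∂(P.map X), Q x) {ρ : ℝ → ℝ}
    (h : ∀ x x', Q x → Q x' → inner ℝ θ₀ x = inner ℝ θ₀ x' → ρ (inner ℝ θ₀ x) ≠ 0 →
      inner ℝ v x = inner ℝ v x') :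
    ∀ᵐ x ∂(P.map X), ρ (inner ℝ θ₀ x) = 0 := by
  have hT : Measurable fun ω => (inner ℝ θ₀ (X ω) : ℝ) := by fun_prop
  have h1 : ∀ᵐ p ∂(P.map fun ω => ((inner ℝ θ₀ (X ω) : ℝ), X ω)),
      Q p.2 ∧ inner ℝ θ₀ p.2 = p.1 := by
    refine Eventually.and ?_ ?_
    · refine ae_of_ae_map (p := Q) measurable_snd.aemeasurable ?_
      rw [Measure.map_map measurable_snd (hT.prodMk hX)]
      exact hQ
    · rw [ae_map_iff (hT.prodMk hX).aemeasurable]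
      · exact Eventually.of_forall fun ω => rfl
      · exact measurableSet_eq_fun (by fun_prop) (by fun_prop)
  rw [← compProd_map_condDistrib hX.aemeasurable] at h1
  have h2 := Measure.ae_ae_of_ae_compProd h1
  have h3 : ∀ᵐ t ∂(P.map fun ω => (inner ℝ θ₀ (X ω) : ℝ)), ρ t = 0 := by
    filter_upwards [h2, hnd v hv] with t ht hnt
    by_contra hρ
    obtain ⟨x₀, hx₀, hx₀t⟩ := ht.exists
    refine hnt ⟨inner ℝ v x₀, ht.mono fun x hx => ?_⟩
    refine h x x₀ hx.1 hx₀ (hx.2.trans hx₀t.symm) ?_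
    rwa [hx.2]
  have h4 : (P.map fun ω => (inner ℝ θ₀ (X ω) : ℝ)) = (P.map X).map (fun x => inner ℝ θ₀ x) := by
    rw [Measure.map_map (by fun_prop) hX]; rfl
  rw [h4] at h3
  exact ae_of_ae_map (by fun_prop) h3

/-! ### Limits of convex functions -/

/-- A convex function that is `e r`-close at `t ± r` to the line of slope `ρ` through its value at
`t` stays within `e |z|` of that line at `t + z` for `|z| ≤ r`: the upper bounds are chords, and the
lower bound at `z` follows from the upper bound at `-z`. -/
theorem ConvexOn.abs_sub_sub_mul_le {f : ℝ → ℝ} (hf : ConvexOn ℝ Set.univ f) {t r ρ e z : ℝ}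
    (hr : 0 < r) (h1 : |f (t + r) - f t - ρ * r| ≤ e * r) (h2 : |f (t - r) - f t + ρ * r| ≤ e * r)
    (hz : |z| ≤ r) : |f (t + z) - f t - ρ * z| ≤ e * |z| := by
  have key : ∀ z, |z| ≤ r → f (t + z) - f t ≤ ρ * z + e * |z| := by
    have aux : ∀ (c y : ℝ), 0 ≤ y → y ≤ r → f (t + c * r) - f t ≤ (ρ * c + e) * r →
        f (t + c * y) - f t ≤ (ρ * c + e) * y := by
      intro c y hy0 hyr hc
      have hyr' : y / r ≤ 1 := (div_le_one hr).2 hyr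
      have := hf.2 (Set.mem_univ t) (Set.mem_univ (t + c * r)) (sub_nonneg.2 hyr')
        (div_nonneg hy0 hr.le) (by ring)
      simp only [smul_eq_mul] at this
      rw [show (1 - y / r) * t + y / r * (t + c * r) = t + c * y by field_simp; ring] at this
      have h3 : f (t + c * y) - f t ≤ y / r * (f (t + c * r) - f t) := by linarith
      refine h3.trans ?_
      calc y / r * (f (t + c * r) - f t) ≤ y / r * ((ρ * c + e) * r) := by gcongr
        _ = _ := by field_simp
    intro z hz
    rcases le_total 0 z with h | h
    · have := aux 1 z h (by rwa [abs_of_nonneg h] at hz) (by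
        rw [one_mul]; linarith [(abs_le.1 h1).2])
      rw [abs_of_nonneg h]; simpa [add_mul] using this
    · have := aux (-1) (-z) (by linarith) (by rwa [abs_of_nonpos h] at hz) (by
        have := (abs_le.1 h2).2
        rw [show t + -1 * r = t - r by ring]; linarith)
      rw [abs_of_nonpos h]
      rw [show t + -1 * -z = t + z by ring] at this
      linarith
  have hmid := hf.2 (Set.mem_univ (t + z)) (Set.mem_univ (t + -z))
    (show (0 : ℝ) ≤ 1 / 2 by norm_num) (show (0 : ℝ) ≤ 1 / 2 by norm_num) (by norm_num)
  simp only [smul_eq_mul] at hmid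
  rw [show 1 / 2 * (t + z) + 1 / 2 * (t + -z) = t by ring] at hmid
  have hm := key (-z) (by rwa [abs_neg])
  rw [abs_neg] at hm
  rw [abs_le]
  constructor
  · linarith
  · linarith [key z hz]

/-- Difference quotients of pointwise convergent convex functions converge to the derivative of the
limit at its points of differentiability. -/
theorem tendsto_diffQuotient_of_convexOn {f : ℕ → ℝ → ℝ} {m : ℝ → ℝ}
    (hf : ∀ k, ConvexOn ℝ Set.univ (f k)) (hlim : ∀ t, Tendsto (fun k => f k t) atTop (nhds (m t)))
    {t : ℝ} (hd : DifferentiableAt ℝ m t) {δ w : ℕ → ℝ} {w' : ℝ} (hδ : ∀ k, 0 < δ k)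
    (hδ0 : Tendsto δ atTop (nhds 0)) (hw : Tendsto w atTop (nhds w')) :
    Tendsto (fun k => (f k (t + δ k * w k) - f k t) / δ k) atTop (nhds (deriv m t * w')) := by
  set ρ := deriv m t
  have hz : Tendsto (fun k => δ k * w k) atTop (nhds 0) := by simpa using hδ0.mul hw
  have key : ∀ e, 0 < e → ∀ᶠ k in atTop,
      |f k (t + δ k * w k) - f k t - ρ * (δ k * w k)| ≤ e * |δ k * w k| := by
    intro e he
    have h1 := hd.hasDerivAt.isLittleO
    have h2 := h1.def (half_pos he)
    obtain ⟨r, hr, hball⟩ := Metric.eventually_nhds_iff.1 h2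
    obtain ⟨q, hq0, hqr⟩ := exists_between hr
    have g1 := hball (y := t + q) (by simp [abs_of_pos hq0, hqr])
    have g2 := hball (y := t - q) (by simp [abs_of_pos hq0, hqr])
    simp [abs_of_pos hq0] at g1 g2
    have l1 : Tendsto (fun k => |f k (t + q) - f k t - ρ * q|) atTop
        (nhds |m (t + q) - m t - ρ * q|) := (((hlim _).sub (hlim _)).sub_const _).abs
    have l2 : Tendsto (fun k => |f k (t - q) - f k t + ρ * q|) atTop
        (nhds |m (t - q) - m t + ρ * q|) := (((hlim _).sub (hlim _)).add_const _).abs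
    have c1 : |m (t + q) - m t - ρ * q| < e * q := by
      have : 0 < e * q := by positivity
      rw [mul_comm ρ]; linarith
    have c2 : |m (t - q) - m t + ρ * q| < e * q := by
      have : 0 < e * q := by positivity
      rw [mul_comm ρ]; linarith
    filter_upwards [l1.eventually_lt_const c1, l2.eventually_lt_const c2,
      hz.abs.eventually_lt_const (show |(0 : ℝ)| < q by simpa using hq0)] with k a1 a2 a3
    exact ConvexOn.abs_sub_sub_mul_le (hf k) hq0 a1.le a2.le a3.le
  have hdiff : Tendsto (fun k => (f k (t + δ k * w k) - f k t) / δ k - ρ * w k) atTop (nhds 0) := by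
    rw [Metric.tendsto_nhds]
    intro e he
    have hW : 0 < |w'| + 1 := by positivity
    filter_upwards [key (e / 2 / (|w'| + 1)) (by positivity),
      hw.abs.eventually_lt_const (lt_add_one |w'|)] with k h1 h2
    rw [dist_zero_right, Real.norm_eq_abs]
    have h3 : (f k (t + δ k * w k) - f k t) / δ k - ρ * w k
        = (f k (t + δ k * w k) - f k t - ρ * (δ k * w k)) / δ k := by
      field_simp [(hδ k).ne']
    rw [h3, abs_div, abs_of_pos (hδ k), div_lt_iff₀ (hδ k)]
    refine h1.trans_lt ?_
    rw [abs_mul, abs_of_pos (hδ k)]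
    have h4 : e / 2 / (|w'| + 1) * |w k| ≤ e / 2 := by
      rw [div_mul_eq_mul_div, div_le_iff₀ hW]
      gcongr
    nlinarith [hδ k]
  have := hdiff.add (hw.const_mul ρ)
  simpa using this

/-- Pointwise sequential compactness of uniformly Lipschitz functions. -/
theorem exists_subseq_tendsto_of_lipschitz {f : ℕ → ℝ → ℝ} {L : ℝ≥0} {B : ℝ}
    (hf : ∀ k, LipschitzWith L (f k)) (hB : ∀ k, |f k 0| ≤ B) :
    ∃ φ : ℕ → ℕ, StrictMono φ ∧
      ∃ m : ℝ → ℝ, ∀ t, Tendsto (fun k => f (φ k) t) atTop (nhds (m t)) := by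
  -- a diagonal argument over the rationals, in the form of compactness of a countable product
  have hcomp : IsCompact
      (Set.univ.pi fun q : ℚ => Set.Icc (-(B + L * |(q : ℝ)|)) (B + L * |(q : ℝ)|)) :=
    isCompact_univ_pi fun q => isCompact_Icc
  have hmem : ∀ k, (fun q : ℚ => f k q) ∈
      Set.univ.pi fun q : ℚ => Set.Icc (-(B + L * |(q : ℝ)|)) (B + L * |(q : ℝ)|) := by
    intro k q _
    have h1 := (hf k).dist_le_mul q 0
    rw [Real.dist_eq, Real.dist_eq, sub_zero] at h1
    have h2 := abs_le.1 h1
    have h3 := abs_le.1 (hB k)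
    constructor <;> linarith
  obtain ⟨a, -, φ, hφ, ha⟩ := hcomp.tendsto_subseq hmem
  rw [tendsto_pi_nhds] at ha
  refine ⟨φ, hφ, ?_⟩
  have hcauchy : ∀ t, CauchySeq fun k => f (φ k) t := by
    intro t
    rw [Metric.cauchySeq_iff']
    intro e he
    have hL : (0 : ℝ) < 3 * (L + 1) := by positivity
    obtain ⟨q, hq1, hq2⟩ := exists_rat_btwn (show t < t + e / (3 * (L + 1)) by
      linarith [div_pos he hL])
    have hq : L * |t - q| ≤ e / 3 := by
      rw [abs_sub_comm, abs_of_pos (by linarith)]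
      have : (q : ℝ) - t ≤ e / (3 * (L + 1)) := by linarith
      calc (L : ℝ) * (q - t) ≤ (L + 1) * (e / (3 * (L + 1))) := by
            gcongr; linarith
        _ = e / 3 := by field_simp
    obtain ⟨n, hn⟩ := Metric.cauchySeq_iff'.1 (ha q).cauchySeq (e / 3) (by positivity)
    refine ⟨n, fun k hk => ?_⟩
    have h1 := hn k hk
    have h2 := (hf (φ k)).dist_le_mul t q
    have h3 := (hf (φ n)).dist_le_mul t q
    rw [Real.dist_eq] at *
    rw [Real.dist_eq] at h2 h3
    simp only [Function.comp] at h1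
    have a1 := abs_lt.1 h1
    have a2 := abs_le.1 (h2.trans hq)
    have a3 := abs_le.1 (h3.trans hq)
    rw [abs_lt]
    constructor <;> linarith
  choose m hm using fun t => cauchySeq_tendsto_of_complete (hcauchy t)
  exact ⟨m, hm⟩

theorem exists_subseq_ae_tendsto_zero {E : Type*} [MeasurableSpace E] {μ : Measure E}
    {h : ℕ → E → ℝ} (hm : ∀ k, MemLp (h k) 2 μ)
    (hlim : Tendsto (fun k => l2norm μ (h k)) atTop (nhds 0)) :
    ∃ φ : ℕ → ℕ, StrictMono φ ∧ ∀ᵐ x ∂μ, Tendsto (fun k => h (φ k) x) atTop (nhds 0) := by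
  have h1 : ∀ k, eLpNorm (h k - 0) 2 μ = ENNReal.ofReal (l2norm μ (h k)) := by
    intro k
    rw [sub_zero, (hm k).eLpNorm_eq_integral_rpow_norm (by norm_num) (by norm_num), l2norm,
      Real.sqrt_eq_rpow]
    simp
  have h2 : Tendsto (fun k => eLpNorm (h k - 0) 2 μ) atTop (nhds 0) := by
    simp_rw [h1]
    simpa using ENNReal.tendsto_ofReal hlim
  exact (tendstoInMeasure_of_tendsto_eLpNorm (by norm_num) (fun k => (hm k).1)
    aestronglyMeasurable_zero h2).exists_seq_tendsto_ae

/-! ### Identifiability and linear separation of the index -/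

section Separation

variable {Ω : Type*} [MeasurableSpace Ω] {P : Measure Ω} [IsProbabilityMeasure P] {d : ℕ} [NeZero d]
  {X : Ω → EuclideanSpace ℝ (Fin d)}

/-- Identifiability of the index. A direction `θ` that is not parallel to `θ₀` would, given
`θ₀ᵀX = t`, take two values at which `m` and `m'` agree; by convexity `m'` vanishes there, hence so
does `m₀' t`. -/
theorem index_eq_of_ae_eq (hX : Measurable X) {d₁ : ℕ} (hd₁ : 1 ≤ d₁)
    (hcont : ContinuousDiscrete P X d₁) {m m₀ : ℝ → ℝ} {L L₀ : ℝ≥0} (hc : ConvexOn ℝ Set.univ m)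
    (hm : LipschitzWith L m) (hm₀ : LipschitzWith L₀ m₀) {θ θ₀ : EuclideanSpace ℝ (Fin d)}
    (hθ : θ ∈ paramSpace d) (hθ₀ : θ₀ ∈ paramSpace d) (hpos : 0 < θ₀ 0)
    (hnd : NondegenerateGivenIndex P X θ₀)
    (hρ : ¬ ∀ᵐ x ∂(P.map X), deriv m₀ (inner ℝ θ₀ x) = 0)
    (h : ∀ᵐ x ∂(P.map X), m (inner ℝ θ x) = m₀ (inner ℝ θ₀ x)) : θ = θ₀ := by
  by_contra hne
  have hv : ∀ c : ℝ, θ ≠ c • θ₀ := by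
    rintro c rfl
    have h1 : |c| = 1 := by
      have := hθ.1
      rwa [norm_smul, hθ₀.1, mul_one] at this
    have h2 : 0 ≤ c * θ₀ 0 := hθ.2
    have h3 : 0 ≤ c := nonneg_of_mul_nonneg_left h2 hpos
    rw [abs_of_nonneg h3] at h1
    exact hne (by rw [h1, one_smul])
  have hdiff : ∀ᵐ x ∂(P.map X), θ 0 ≠ 0 → DifferentiableAt ℝ m (inner ℝ θ x) := by
    by_cases h0 : θ 0 = 0
    · exact Eventually.of_forall fun x hx => absurd h0 hx
    · exact (ae_inner_of_ae_volume hX hd₁ hcont h0 hm.ae_differentiableAt).mono fun x hx _ => hx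
  have hQ := (h.and (ae_deriv_eq_of_ae_eq hX hd₁ hcont hm hm₀ h)).and hdiff
  refine hρ (hnd.ae_eq_zero hX hv hQ fun x x' hx hx' hxx' hne0 => ?_)
  obtain ⟨⟨e1, e2⟩, e3⟩ := hx
  obtain ⟨⟨e1', e2'⟩, e3'⟩ := hx'
  rw [← hxx'] at e1' e2'
  have hθ0 : θ 0 ≠ 0 := by
    intro h0
    rw [h0, zero_mul] at e2
    exact mul_ne_zero hpos.ne' hne0 e2.symm
  have hd0 : deriv m (inner ℝ θ x) ≠ 0 := by
    intro h0
    rw [h0, mul_zero] at e2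
    exact mul_ne_zero hpos.ne' hne0 e2.symm
  have key : ∀ s t : ℝ, s < t → m s = m t → deriv m s = deriv m t → DifferentiableAt ℝ m s →
      DifferentiableAt ℝ m t → deriv m s = 0 := by
    intro s t hst hmst hd hds hdt
    have h1 := hc.deriv_le_slope (Set.mem_univ s) (Set.mem_univ t) hst hds
    have h2 := hc.slope_le_deriv (Set.mem_univ s) (Set.mem_univ t) hst hdt
    rw [slope_def_field, hmst, sub_self, zero_div] at h1 h2
    linarith
  have hmm : m (inner ℝ θ x) = m (inner ℝ θ x') := e1.trans e1'.symm
  have hdd : deriv m (inner ℝ θ x) = deriv m (inner ℝ θ x') :=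
    mul_left_cancel₀ hθ0 (e2.trans e2'.symm)
  rcases lt_trichotomy (inner ℝ θ x) (inner ℝ θ x') with hlt | heq | hlt
  · exact absurd (key _ _ hlt hmm hdd (e3 hθ0) (e3' hθ0)) hd0
  · exact heq
  · exact absurd (hdd.trans (key _ _ hlt hmm.symm hdd.symm (e3' hθ0) (e3 hθ0))) hd0

/-- Linear separation: the `L₂` distance of `m ∘ θ` to the truth dominates the distance of the
indices, uniformly over the class. Otherwise there are `f k`, `θ k` for which the residuals
`f k ∘ θ k - m₀ ∘ θ₀`, divided by `δ k = ‖θ k - θ₀‖`, tend to zero. By compactness `f k → m`,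
`θ k → θ₀` and `(θ k - θ₀) / δ k → v`, and comparing the difference quotients of `f k` shows that
`(f k - m₀) (θ₀ᵀx) / δ k` tends to `-m₀' (θ₀ᵀx) * vᵀx`. The limit is thus a function of `θ₀ᵀx`, which
nondegeneracy excludes because `v` is orthogonal to `θ₀`. No differentiability of `f k` and no rate
for `f k → m` is needed. -/
theorem exists_norm_sub_le_mul_l2norm (hX : Measurable X) {d₁ : ℕ} (hd₁ : 1 ≤ d₁)
    (hcont : ContinuousDiscrete P X d₁) {m₀ : ℝ → ℝ} {L L₀ : ℝ≥0}
    (hm₀ : LipschitzWith L₀ m₀) {θ₀ : EuclideanSpace ℝ (Fin d)}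
    (hθ₀ : θ₀ ∈ paramSpace d) (hpos : 0 < θ₀ 0)
    (hnd : NondegenerateGivenIndex P X θ₀)
    (hρ : ¬ ∀ᵐ x ∂(P.map X), deriv m₀ (inner ℝ θ₀ x) = 0)
    {R : ℝ} (hR : ∀ᵐ x ∂(P.map X), ‖x‖ ≤ R) :
    ∃ c : ℝ, 0 < c ∧ ∀ m : ℝ → ℝ, ConvexOn ℝ Set.univ m → LipschitzWith L m →
      ∀ θ ∈ paramSpace d, ‖θ - θ₀‖ ≤
        c * l2norm (P.map X) (fun x => m (inner ℝ θ x) - m₀ (inner ℝ θ₀ x)) := by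
  have hPX : IsProbabilityMeasure (P.map X) := Measure.isProbabilityMeasure_map hX.aemeasurable
  by_contra hcon
  push Not at hcon
  choose f hfc hfl θ hθ hlt using fun k : ℕ => hcon (k + 1) (by positivity)
  obtain ⟨δ, hδ⟩ : ∃ δ : ℕ → ℝ, δ = fun k => ‖θ k - θ₀‖ := ⟨_, rfl⟩
  have hnn : ∀ g : EuclideanSpace ℝ (Fin d) → ℝ, 0 ≤ l2norm (P.map X) g := fun g =>
    Real.sqrt_nonneg _
  have hδpos : ∀ k, 0 < δ k := fun k => by
    rw [hδ]; exact lt_of_le_of_lt (mul_nonneg (by positivity) (hnn _)) (hlt k)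
  have hδle : ∀ k, δ k ≤ 2 := fun k => by
    rw [hδ]
    refine (norm_sub_le _ _).trans ?_
    rw [(hθ k).1, hθ₀.1]; norm_num
  obtain ⟨h, hh⟩ : ∃ h : ℕ → EuclideanSpace ℝ (Fin d) → ℝ,
      h = fun k x => (f k (inner ℝ (θ k) x) - m₀ (inner ℝ θ₀ x)) / δ k := ⟨_, rfl⟩
  have hbound : ∀ (m : ℝ → ℝ) (K : ℝ≥0), LipschitzWith K m → ∀ η ∈ paramSpace d,
      ∀ x : EuclideanSpace ℝ (Fin d), |m (inner ℝ η x) - m 0| ≤ K * ‖x‖ := by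
    intro m K hm η hη x
    have h1 := hm.dist_le_mul (inner ℝ η x) 0
    rw [Real.dist_eq, Real.dist_eq, sub_zero] at h1
    refine h1.trans (mul_le_mul_of_nonneg_left ?_ K.coe_nonneg)
    simpa [hη.1] using abs_real_inner_le_norm η x
  have hmem : ∀ k, MemLp (h k) 2 (P.map X) := fun k => by
    refine MemLp.of_bound (C := (|f k 0| + L * R + (|m₀ 0| + L₀ * R)) / δ k) ?_ ?_
    · refine Continuous.aestronglyMeasurable ?_
      rw [hh]
      exact (((hfl k).continuous.comp (by fun_prop)).sub
        (hm₀.continuous.comp (by fun_prop))).div_const _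
    · filter_upwards [hR] with x hx
      rw [hh]
      simp only [norm_div, Real.norm_eq_abs, abs_of_pos (hδpos k)]
      refine div_le_div_of_nonneg_right ?_ (hδpos k).le
      have a1 := hbound _ _ (hfl k) _ (hθ k) x
      have a2 := hbound _ _ hm₀ _ hθ₀ x
      have b1 := mul_le_mul_of_nonneg_left hx L.coe_nonneg
      have b2 := mul_le_mul_of_nonneg_left hx L₀.coe_nonneg
      have c1 := abs_le.1 (a1.trans b1)
      have c2 := abs_le.1 (a2.trans b2)
      have d1 := abs_le.1 (le_refl |f k 0|)
      have d2 := abs_le.1 (le_refl |m₀ 0|)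
      rw [abs_le]; constructor <;> linarith
  have hnorm : ∀ k, l2norm (P.map X) (h k) ≤ 1 / ((k : ℝ) + 1) := fun k => by
    have e1 : l2norm (P.map X) (h k) = l2norm (P.map X)
        (fun x => f k (inner ℝ (θ k) x) - m₀ (inner ℝ θ₀ x)) / δ k := by
      rw [hh, l2norm, l2norm]
      simp_rw [div_pow]
      rw [integral_div, Real.sqrt_div' _ (by positivity), Real.sqrt_sq (hδpos k).le]
    rw [e1, div_le_div_iff₀ (hδpos k) (by positivity), one_mul, mul_comm]
    have := (hlt k).le
    rw [hδ]; exact this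
  have hlim : Tendsto (fun k => l2norm (P.map X) (h k)) atTop (nhds 0) :=
    squeeze_zero (fun k => hnn _) hnorm tendsto_one_div_add_atTop_nhds_zero_nat
  obtain ⟨φ, hφ, hae⟩ := exists_subseq_ae_tendsto_zero hmem hlim
  -- the values at one point of convergence bound the sequence of links at the origin
  obtain ⟨B, hB⟩ : ∃ B, ∀ k, |f (φ k) 0| ≤ B := by
    obtain ⟨x, hx⟩ := hae.exists
    obtain ⟨b, hb⟩ := hx.abs.bddAbove_range
    refine ⟨2 * b + |m₀ (inner ℝ θ₀ x)| + L * ‖x‖, fun k => ?_⟩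
    have a1 := hb ⟨k, rfl⟩
    have a2 := hbound _ _ (hfl (φ k)) _ (hθ (φ k)) x
    have a3 : f (φ k) (inner ℝ (θ (φ k)) x) = δ (φ k) * h (φ k) x + m₀ (inner ℝ θ₀ x) := by
      rw [hh]; field_simp [(hδpos (φ k)).ne']; ring
    have a4 : |δ (φ k) * h (φ k) x| ≤ 2 * b := by
      rw [abs_mul, abs_of_pos (hδpos _)]
      exact mul_le_mul (hδle _) a1 (abs_nonneg _) (by norm_num)
    rw [a3] at a2
    have c1 := abs_le.1 a2
    have c2 := abs_le.1 a4
    have c3 := abs_le.1 (le_refl |m₀ (inner ℝ θ₀ x)|)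
    rw [abs_le]; constructor <;> linarith
  obtain ⟨ψ, hψ, m, hm⟩ := exists_subseq_tendsto_of_lipschitz (fun k => hfl (φ k)) hB
  have hsph : ∀ k, (θ (φ (ψ k)), (δ (φ (ψ k)))⁻¹ • (θ (φ (ψ k)) - θ₀)) ∈
      Metric.sphere (0 : EuclideanSpace ℝ (Fin d)) 1 ×ˢ
        Metric.sphere (0 : EuclideanSpace ℝ (Fin d)) 1 := fun k => by
    refine ⟨by simpa using (hθ _).1, ?_⟩
    rw [mem_sphere_zero_iff_norm, norm_smul, norm_inv, Real.norm_eq_abs, abs_of_pos (hδpos _)]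
    have : ‖θ (φ (ψ k)) - θ₀‖ = δ (φ (ψ k)) := by rw [hδ]
    rw [this]; exact inv_mul_cancel₀ (hδpos _).ne'
  obtain ⟨⟨θ', v⟩, hmemv, ξ, hξ, hconv⟩ :=
    ((isCompact_sphere _ _).prod (isCompact_sphere _ _)).tendsto_subseq hsph
  obtain ⟨χ, hχ⟩ : ∃ χ : ℕ → ℕ, χ = fun k => φ (ψ (ξ k)) := ⟨_, rfl⟩
  have hθlim : Tendsto (fun k => θ (χ k)) atTop (nhds θ') := by
    rw [hχ]; exact (continuous_fst.tendsto _).comp hconv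
  have hvlim : Tendsto (fun k => (δ (χ k))⁻¹ • (θ (χ k) - θ₀)) atTop (nhds v) := by
    rw [hχ]; exact (continuous_snd.tendsto _).comp hconv
  have hflim : ∀ t, Tendsto (fun k => f (χ k) t) atTop (nhds (m t)) := fun t => by
    rw [hχ]; exact (hm t).comp hξ.tendsto_atTop
  have hhlim : ∀ᵐ x ∂(P.map X), Tendsto (fun k => h (χ k) x) atTop (nhds 0) :=
    hae.mono fun x hx => by
      rw [hχ]; exact hx.comp (hψ.comp hξ).tendsto_atTop
  have hv1 : ‖v‖ = 1 := by simpa using hmemv.2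
  have hmlip : LipschitzWith L m := LipschitzWith.of_dist_le_mul fun s t =>
    le_of_tendsto ((hflim s).dist (hflim t))
      (Eventually.of_forall fun k => (hfl (χ k)).dist_le_mul s t)
  have hmconv : ConvexOn ℝ Set.univ m := ⟨convex_univ, fun s _ t _ a b ha hb hab =>
    le_of_tendsto_of_tendsto' (hflim _) (((hflim s).const_smul a).add ((hflim t).const_smul b))
      fun k => (hfc (χ k)).2 (Set.mem_univ s) (Set.mem_univ t) ha hb hab⟩
  have hθ' : θ' ∈ paramSpace d := by
    have h0 : Tendsto (fun k => θ (χ k) 0) atTop (nhds (θ' 0)) :=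
      ((EuclideanSpace.proj (𝕜 := ℝ) (0 : Fin d)).continuous.tendsto θ').comp hθlim
    exact ⟨by simpa using hmemv.1, ge_of_tendsto' h0 fun k => (hθ (χ k)).2⟩
  have hcomp : ∀ x, Tendsto (fun k => f (χ k) (inner ℝ (θ (χ k)) x)) atTop
      (nhds (m (inner ℝ θ' x))) := by
    intro x
    have h1 : Tendsto (fun k => (inner ℝ (θ (χ k)) x : ℝ)) atTop (nhds (inner ℝ θ' x)) :=
      hθlim.inner tendsto_const_nhds
    have h2 : Tendsto (fun k => f (χ k) (inner ℝ (θ (χ k)) x) - f (χ k) (inner ℝ θ' x)) atTop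
        (nhds 0) := by
      refine squeeze_zero_norm (a := fun k => L * dist (inner ℝ (θ (χ k)) x : ℝ) (inner ℝ θ' x))
        (fun k => (hfl (χ k)).dist_le_mul _ _) ?_
      simpa using (tendsto_iff_dist_tendsto_zero.1 h1).const_mul (L : ℝ)
    simpa using h2.add (hflim (inner ℝ θ' x))
  have hident : ∀ᵐ x ∂(P.map X), m (inner ℝ θ' x) = m₀ (inner ℝ θ₀ x) := by
    filter_upwards [hhlim] with x hx
    have h1 : Tendsto (fun k => δ (χ k) * h (χ k) x) atTop (nhds 0) := by
      refine squeeze_zero_norm (a := fun k => 2 * |h (χ k) x|) (fun k => ?_) ?_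
      · rw [Real.norm_eq_abs, abs_mul, abs_of_pos (hδpos _)]
        gcongr; exact hδle _
      · simpa using hx.abs.const_mul 2
    have h2 : ∀ k, δ (χ k) * h (χ k) x = f (χ k) (inner ℝ (θ (χ k)) x) - m₀ (inner ℝ θ₀ x) := by
      intro k
      rw [hh]; field_simp [(hδpos (χ k)).ne']
    simp_rw [h2] at h1
    have := tendsto_nhds_unique h1 ((hcomp x).sub_const _)
    linarith
  have hθeq : θ' = θ₀ := index_eq_of_ae_eq hX hd₁ hcont hmconv hmlip hm₀ hθ' hθ₀ hpos hnd hρ hident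
  rw [hθeq] at hident hθlim
  have hδlim : Tendsto (fun k => δ (χ k)) atTop (nhds 0) := by
    rw [hδ]; exact tendsto_iff_norm_sub_tendsto_zero.1 hθlim
  -- all `θ k` are unit vectors, so the limit direction `v` is orthogonal to `θ₀`
  have horth : inner ℝ v θ₀ = 0 := by
    have h1 : Tendsto (fun k => (inner ℝ ((δ (χ k))⁻¹ • (θ (χ k) - θ₀)) (θ (χ k) + θ₀) : ℝ)) atTop
        (nhds (inner ℝ v (θ₀ + θ₀))) := hvlim.inner (hθlim.add_const θ₀)
    have h2 : ∀ k, (inner ℝ ((δ (χ k))⁻¹ • (θ (χ k) - θ₀)) (θ (χ k) + θ₀) : ℝ) = 0 := fun k => by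
      rw [inner_smul_left, inner_sub_left, inner_add_right, inner_add_right,
        real_inner_self_eq_norm_sq, real_inner_self_eq_norm_sq, (hθ _).1, hθ₀.1,
        real_inner_comm θ₀ (θ (χ k))]
      ring
    simp_rw [h2] at h1
    have := tendsto_nhds_unique h1 tendsto_const_nhds
    rw [inner_add_right] at this
    linarith
  have hvne : ∀ c : ℝ, v ≠ c • θ₀ := by
    rintro c rfl
    rw [inner_smul_left, real_inner_self_eq_norm_sq, hθ₀.1] at horth
    have : c = 0 := by simpa using horth
    rw [this, zero_smul, norm_zero] at hv1
    exact zero_ne_one hv1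
  refine hρ (hnd.ae_eq_zero hX hvne (Q := fun x =>
    Tendsto (fun k => (f (χ k) (inner ℝ θ₀ x) - m₀ (inner ℝ θ₀ x)) / δ (χ k)) atTop
      (nhds (0 - deriv m₀ (inner ℝ θ₀ x) * inner ℝ v x))) ?_ ?_)
  · filter_upwards [hhlim, ae_deriv_eq_of_ae_eq hX hd₁ hcont hmlip hm₀ hident,
      ae_inner_of_ae_volume hX hd₁ hcont hpos.ne' hmlip.ae_differentiableAt] with x h1 h2 h3
    have h4 : deriv m (inner ℝ θ₀ x) = deriv m₀ (inner ℝ θ₀ x) := mul_left_cancel₀ hpos.ne' h2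
    have h5 := tendsto_diffQuotient_of_convexOn (fun k => hfc (χ k)) hflim h3
      (fun k => hδpos (χ k)) hδlim (hvlim.inner (tendsto_const_nhds (x := x)))
    rw [h4] at h5
    refine (h1.sub h5).congr fun k => ?_
    have h6 : (inner ℝ θ₀ x : ℝ) + δ (χ k) * inner ℝ ((δ (χ k))⁻¹ • (θ (χ k) - θ₀)) x
        = inner ℝ (θ (χ k)) x := by
      rw [inner_smul_left, inner_sub_left]
      simp only [conj_trivial]
      rw [mul_inv_cancel_left₀ (hδpos _).ne']; ring
    rw [h6, hh]
    simp only
    rw [← sub_div]; congr 1; ring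
  · intro x x' hx hx' hxx' hne
    rw [← hxx'] at hx'
    have := tendsto_nhds_unique hx hx'
    exact mul_left_cancel₀ hne (by linarith)

end Separation

/-! ### Conditionally sub-Gaussian noise and exponential inequalities -/

section Noise

variable {Ω E : Type*} [MeasurableSpace Ω] [MeasurableSpace E] {P : Measure Ω}

/-- The noise `e` is centred and sub-Gaussian given the covariate `X`: `E(e | X) = 0` and
`E(exp (e² / K) - 1 | X) ≤ 1 / K`, both tested against bounded measurable functions of `X`. -/
structure IsSubGaussianNoise (P : Measure Ω) (X : Ω → E) (e : Ω → ℝ) (K : ℝ) : Prop where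
  pos : 0 < K
  measurable : Measurable e
  integrable_exp : Integrable (fun ω => Real.exp (e ω ^ 2 / K)) P
  integral_mul_eq_zero : ∀ b : E → ℝ, Measurable b → (∃ C, ∀ x, |b x| ≤ C) →
    ∫ ω, b (X ω) * e ω ∂P = 0
  integral_mul_exp_le : ∀ c : E → ℝ, Measurable c → (∀ x, 0 ≤ c x) → (∃ C, ∀ x, c x ≤ C) →
    ∫ ω, c (X ω) * (Real.exp (e ω ^ 2 / K) - 1) ∂P ≤ (∫ ω, c (X ω) ∂P) / K

theorem exp_le_id_add_exp_sq (x : ℝ) : Real.exp x ≤ x + Real.exp (x ^ 2) := by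
  have h1 := Real.add_one_le_exp (x ^ 2)
  rcases le_total |x| 1 with h | h
  · have := (abs_le.1 (Real.abs_exp_sub_one_sub_id_le h)).2
    linarith
  · rcases le_abs.1 h with h | h
    · have : Real.exp x ≤ Real.exp (x ^ 2) := Real.exp_le_exp.2 (by nlinarith)
      linarith
    · have : Real.exp x ≤ 1 := Real.exp_le_one_iff.2 (by linarith)
      nlinarith

theorem exp_mul_le_of_le_one {u z : ℝ} (hu0 : 0 ≤ u) (hu1 : u ≤ 1) :
    Real.exp (u * z) ≤ 1 + u * (Real.exp z - 1) := by
  have := convexOn_exp.2 (Set.mem_univ z) (Set.mem_univ 0) hu0 (sub_nonneg.2 hu1) (by ring)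
  simp only [smul_eq_mul, mul_zero, add_zero, Real.exp_zero, mul_one] at this
  linarith

/-- The exponential `exp (s e)` is dominated by an affine function of `e` and `exp (e² / K) - 1`
whose expectation under the sub-Gaussian noise condition is at most `exp ((1 + K) s²)`. -/
theorem exists_exp_mul_le {K : ℝ} (hK : 0 < K) : ∃ a b c : ℝ → ℝ,
    Measurable a ∧ Measurable b ∧ Measurable c ∧ (∀ s, 0 ≤ c s) ∧
    (∀ s, |a s| ≤ Real.exp (K * s ^ 2)) ∧ (∀ s, |b s| ≤ |s|) ∧
    (∀ s, c s ≤ 1 + Real.exp (K * s ^ 2)) ∧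
    (∀ s, a s + c s / K ≤ Real.exp ((1 + K) * s ^ 2)) ∧
    ∀ s e, Real.exp (s * e) ≤ a s + b s * e + c s * (Real.exp (e ^ 2 / K) - 1) := by
  have hset : MeasurableSet {s : ℝ | s ^ 2 * K ≤ 1} := measurableSet_le (by fun_prop) (by fun_prop)
  refine ⟨fun s => if s ^ 2 * K ≤ 1 then 1 else Real.exp (s ^ 2 * K / 2),
    fun s => if s ^ 2 * K ≤ 1 then s else 0,
    fun s => if s ^ 2 * K ≤ 1 then s ^ 2 * K else Real.exp (s ^ 2 * K / 2) / 2,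
    Measurable.ite hset (by fun_prop) (by fun_prop), Measurable.ite hset (by fun_prop) (by fun_prop),
    Measurable.ite hset (by fun_prop) (by fun_prop), ?_, ?_, ?_, ?_, ?_, ?_⟩
  · intro s; dsimp only; split_ifs <;> positivity
  · intro s; dsimp only; split_ifs with h
    · rw [abs_one]; exact Real.one_le_exp (by positivity)
    · rw [Real.abs_exp, Real.exp_le_exp]; nlinarith [sq_nonneg s]
  · intro s; dsimp only; split_ifs with h
    · exact le_rfl
    · simp
  · intro s; dsimp only; split_ifs with h
    · linarith [Real.exp_pos (K * s ^ 2)]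
    · have : Real.exp (s ^ 2 * K / 2) ≤ Real.exp (K * s ^ 2) :=
        Real.exp_le_exp.2 (by nlinarith [sq_nonneg s])
      linarith [Real.exp_pos (s ^ 2 * K / 2)]
  · intro s; dsimp only; split_ifs with h
    · rw [mul_div_assoc, div_self hK.ne', mul_one]
      have h1 := Real.add_one_le_exp (s ^ 2)
      have h2 : Real.exp (s ^ 2) ≤ Real.exp ((1 + K) * s ^ 2) :=
        Real.exp_le_exp.2 (by nlinarith [sq_nonneg s])
      linarith
    · push Not at h
      have h0 : 1 / K < s ^ 2 := by rwa [div_lt_iff₀ hK]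
      have h1 : 1 + 1 / K / 2 ≤ Real.exp (1 / K / 2) := by linarith [Real.add_one_le_exp (1 / K / 2)]
      calc Real.exp (s ^ 2 * K / 2) + Real.exp (s ^ 2 * K / 2) / 2 / K
          = Real.exp (s ^ 2 * K / 2) * (1 + 1 / K / 2) := by ring
        _ ≤ Real.exp (s ^ 2 * K / 2) * Real.exp (1 / K / 2) := by gcongr
        _ = Real.exp (s ^ 2 * K / 2 + 1 / K / 2) := (Real.exp_add _ _).symm
        _ ≤ _ := Real.exp_le_exp.2 (by nlinarith [sq_nonneg s, mul_nonneg (sq_nonneg s) hK.le])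
  · intro s e; dsimp only
    split_ifs with h
    · have h1 := exp_le_id_add_exp_sq (s * e)
      have h2 := exp_mul_le_of_le_one (u := s ^ 2 * K) (z := e ^ 2 / K) (by positivity) h
      have h3 : s ^ 2 * K * (e ^ 2 / K) = (s * e) ^ 2 := by field_simp
      rw [h3] at h2
      linarith
    · have h2 := exp_mul_le_of_le_one (u := 1 / 2) (z := e ^ 2 / K) (by norm_num) (by norm_num)
      have h3 : s * e ≤ s ^ 2 * K / 2 + 1 / 2 * (e ^ 2 / K) := by
        have : s ^ 2 * K / 2 + 1 / 2 * (e ^ 2 / K) - s * e = (s * K - e) ^ 2 / (2 * K) := by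
          field_simp; ring
        have : 0 ≤ (s * K - e) ^ 2 / (2 * K) := by positivity
        linarith
      calc Real.exp (s * e) ≤ Real.exp (s ^ 2 * K / 2 + 1 / 2 * (e ^ 2 / K)) := Real.exp_le_exp.2 h3
        _ = Real.exp (s ^ 2 * K / 2) * Real.exp (1 / 2 * (e ^ 2 / K)) := Real.exp_add _ _
        _ ≤ Real.exp (s ^ 2 * K / 2) * (1 + 1 / 2 * (Real.exp (e ^ 2 / K) - 1)) := by gcongr
        _ = _ := by ring

theorem abs_le_one_add_mul_exp {K : ℝ} (hK : 0 < K) (e : ℝ) :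
    |e| ≤ 1 + K * Real.exp (e ^ 2 / K) := by
  have h1 := Real.add_one_le_exp (e ^ 2 / K)
  have h2 : e ^ 2 ≤ K * Real.exp (e ^ 2 / K) := by
    rw [mul_comm, ← div_le_iff₀ hK]; linarith
  nlinarith [sq_abs e, sq_nonneg (|e| - 1), abs_nonneg e]

variable {X : Ω → E} {e : Ω → ℝ} {K : ℝ}

theorem IsSubGaussianNoise.integrable [IsFiniteMeasure P] (he : IsSubGaussianNoise P X e K) :
    Integrable e P := by
  refine Integrable.mono' ((integrable_const 1).add (he.integrable_exp.const_mul K))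
    he.measurable.aestronglyMeasurable (Eventually.of_forall fun ω => ?_)
  exact abs_le_one_add_mul_exp he.pos (e ω)

theorem integrable_of_abs_le [IsFiniteMeasure P] (hX : Measurable X) {f : E → ℝ}
    (hf : Measurable f) {C : ℝ} (hC : ∀ x, |f x| ≤ C) : Integrable (fun ω => f (X ω)) P :=
  Integrable.of_bound (hf.comp hX).aestronglyMeasurable C (Eventually.of_forall fun _ => hC _)

theorem IsSubGaussianNoise.integrable_mul_exp [IsFiniteMeasure P]
    (he : IsSubGaussianNoise P X e K) (hX : Measurable X) {s w : E → ℝ} (hs : Measurable s)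
    (hw : Measurable w) {S W : ℝ} (hS : ∀ x, |s x| ≤ S) (hW : ∀ x, |w x| ≤ W) :
    Integrable (fun ω => w (X ω) * Real.exp (s (X ω) * e ω)) P := by
  have hm := he.measurable
  refine Integrable.bdd_mul (c := W) ?_ (hw.comp hX).aestronglyMeasurable
    (Eventually.of_forall fun ω => hW _)
  refine Integrable.mono' (he.integrable_exp.const_mul (Real.exp (K * S ^ 2)))
    (by fun_prop) (Eventually.of_forall fun ω => ?_)
  rw [Real.norm_eq_abs, Real.abs_exp, ← Real.exp_add, Real.exp_le_exp]
  have h1 : s (X ω) ^ 2 ≤ S ^ 2 := sq_le_sq' (abs_le.1 (hS _)).1 (abs_le.1 (hS _)).2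
  have h2 : K * s (X ω) ^ 2 + e ω ^ 2 / K - 2 * (s (X ω) * e ω) = (s (X ω) * K - e ω) ^ 2 / K := by
    field_simp [he.pos.ne']; ring
  have h3 : 0 ≤ (s (X ω) * K - e ω) ^ 2 / K := div_nonneg (sq_nonneg _) he.pos.le
  have h4 : 0 ≤ K * s (X ω) ^ 2 + e ω ^ 2 / K :=
    add_nonneg (mul_nonneg he.pos.le (sq_nonneg _)) (div_nonneg (sq_nonneg _) he.pos.le)
  have h5 := mul_le_mul_of_nonneg_left h1 he.pos.le
  linarith

/-- The conditional moment generating function of the noise, `E(exp (s e) | X) ≤ exp ((1 + K) s²)` for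
`s` a function of `X`, tested against weights `w`. -/
theorem IsSubGaussianNoise.integral_mul_exp_mul_le [IsFiniteMeasure P]
    (he : IsSubGaussianNoise P X e K) (hX : Measurable X) {s w : E → ℝ} (hs : Measurable s)
    (hw : Measurable w) {S W : ℝ} (hS : ∀ x, |s x| ≤ S) (hw0 : ∀ x, 0 ≤ w x) (hW : ∀ x, w x ≤ W) :
    ∫ ω, w (X ω) * Real.exp (s (X ω) * e ω) ∂P
      ≤ ∫ ω, w (X ω) * Real.exp ((1 + K) * s (X ω) ^ 2) ∂P := by
  have hK := he.pos
  obtain ⟨a, b, c, ha, hb, hc, hc0, haB, hbB, hcB, hac, hexp⟩ := exists_exp_mul_le hK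
  have hWabs : ∀ x, |w x| ≤ W := fun x => by rw [abs_of_nonneg (hw0 x)]; exact hW x
  have hs2 : ∀ x, s x ^ 2 ≤ S ^ 2 := fun x => sq_le_sq' (abs_le.1 (hS x)).1 (abs_le.1 (hS x)).2
  have hbdd : ∀ {u : E → ℝ} {U : ℝ}, (∀ x, |u x| ≤ U) → ∀ x, |w x * u x| ≤ W * U :=
    fun hu x => by
      rw [abs_mul]
      exact mul_le_mul (hWabs x) (hu x) (abs_nonneg _) ((abs_nonneg _).trans (hWabs x))
  have hae : ∀ x, |a (s x)| ≤ Real.exp (K * S ^ 2) := fun x =>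
    (haB _).trans (Real.exp_le_exp.2 (mul_le_mul_of_nonneg_left (hs2 x) hK.le))
  have hbe : ∀ x, |b (s x)| ≤ S := fun x => (hbB _).trans (hS x)
  have hce : ∀ x, |c (s x)| ≤ 1 + Real.exp (K * S ^ 2) := fun x => by
    rw [abs_of_nonneg (hc0 _)]
    exact (hcB _).trans (add_le_add le_rfl
      (Real.exp_le_exp.2 (mul_le_mul_of_nonneg_left (hs2 x) hK.le)))
  have hma : Measurable fun x => w x * a (s x) := hw.mul (ha.comp hs)
  have hmb : Measurable fun x => w x * b (s x) := hw.mul (hb.comp hs)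
  have hmc : Measurable fun x => w x * c (s x) := hw.mul (hc.comp hs)
  have ia := integrable_of_abs_le (P := P) hX hma (hbdd hae)
  have ic := integrable_of_abs_le (P := P) hX hmc (hbdd hce)
  have ib : Integrable (fun ω => (w (X ω) * b (s (X ω))) * e ω) P :=
    he.integrable.bdd_mul (hmb.comp hX).aestronglyMeasurable
      (Eventually.of_forall fun ω => hbdd hbe (X ω))
  have id : Integrable (fun ω => (w (X ω) * c (s (X ω))) * (Real.exp (e ω ^ 2 / K) - 1)) P :=
    (he.integrable_exp.sub (integrable_const 1)).bdd_mul (hmc.comp hX).aestronglyMeasurable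
      (Eventually.of_forall fun ω => hbdd hce (X ω))
  have iexp : Integrable (fun ω => w (X ω) * Real.exp ((1 + K) * s (X ω) ^ 2)) P := by
    refine integrable_of_abs_le (P := P) hX (f := fun x => w x * Real.exp ((1 + K) * s x ^ 2))
      (by fun_prop) (hbdd (U := Real.exp ((1 + K) * S ^ 2)) fun x => ?_)
    rw [Real.abs_exp, Real.exp_le_exp]
    exact mul_le_mul_of_nonneg_left (hs2 x) (by linarith)
  calc ∫ ω, w (X ω) * Real.exp (s (X ω) * e ω) ∂P
      ≤ ∫ ω, (w (X ω) * a (s (X ω)) + (w (X ω) * b (s (X ω))) * e ω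
          + (w (X ω) * c (s (X ω))) * (Real.exp (e ω ^ 2 / K) - 1)) ∂P := by
        refine integral_mono (he.integrable_mul_exp hX hs hw hS hWabs) ((ia.add ib).add id)
          fun ω => ?_
        have := mul_le_mul_of_nonneg_left (hexp (s (X ω)) (e ω)) (hw0 (X ω))
        linarith
    _ = ∫ ω, w (X ω) * a (s (X ω)) ∂P
          + ∫ ω, (w (X ω) * c (s (X ω))) * (Real.exp (e ω ^ 2 / K) - 1) ∂P := by
        have h1 := integral_add (ia.add ib) id
        simp only [Pi.add_apply] at h1
        rw [h1, integral_add ia ib,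
          he.integral_mul_eq_zero _ hmb ⟨_, hbdd hbe⟩, add_zero]
    _ ≤ ∫ ω, w (X ω) * a (s (X ω)) ∂P + (∫ ω, w (X ω) * c (s (X ω)) ∂P) / K := by
        gcongr
        exact he.integral_mul_exp_le _ hmc (fun x => mul_nonneg (hw0 x) (hc0 _))
          ⟨_, fun x => (le_abs_self _).trans (hbdd hce x)⟩
    _ = ∫ ω, (w (X ω) * a (s (X ω)) + w (X ω) * c (s (X ω)) / K) ∂P := by
        rw [integral_add ia (ic.div_const K), integral_div]
    _ ≤ _ := by
        refine integral_mono (ia.add (ic.div_const K)) iexp fun ω => ?_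
        have := mul_le_mul_of_nonneg_left (hac (s (X ω))) (hw0 (X ω))
        rw [mul_add] at this
        rwa [mul_div_assoc]

end Noise

section Chernoff

variable {Ω E : Type*} [MeasurableSpace Ω] [MeasurableSpace E] {P : Measure Ω}
  [IsProbabilityMeasure P] {X : ℕ → Ω → E} {Y : ℕ → Ω → ℝ} {f₀ : E → ℝ} {K : ℝ}

/-- Chernoff bound for sums of functions of the i.i.d. data, with the exponential parameter absorbed
in `φ`. -/
theorem measureReal_le_sum_le (hX : ∀ i, Measurable (X i)) (hY : ∀ i, Measurable (Y i))
    (hindep : iIndepFun (fun i ω => (X i ω, Y i ω)) P)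
    (hident : ∀ i, IdentDistrib (fun ω => (X i ω, Y i ω)) (fun ω => (X 0 ω, Y 0 ω)) P P)
    {φ : E × ℝ → ℝ} (hφ : Measurable φ)
    (hint : Integrable (fun ω => Real.exp (φ (X 0 ω, Y 0 ω))) P) {a : ℝ}
    (hle : ∫ ω, Real.exp (φ (X 0 ω, Y 0 ω)) ∂P ≤ Real.exp a) (n : ℕ) (t : ℝ) :
    P.real {ω | t ≤ ∑ i ∈ Finset.range n, φ (X i ω, Y i ω)} ≤ Real.exp (n * a - t) := by
  have hZ : ∀ i, Measurable fun ω => φ (X i ω, Y i ω) := fun i =>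
    hφ.comp ((hX i).prodMk (hY i))
  have hind : iIndepFun (fun i ω => φ (X i ω, Y i ω)) P := hindep.comp (fun _ => φ) fun _ => hφ
  have hid : ∀ i, IdentDistrib (fun ω => Real.exp (φ (X i ω, Y i ω)))
      (fun ω => Real.exp (φ (X 0 ω, Y 0 ω))) P P := fun i =>
    (hident i).comp (u := fun z => Real.exp (φ z)) (Real.measurable_exp.comp hφ)
  have hints : ∀ i ∈ Finset.range n, Integrable (fun ω => Real.exp (1 * φ (X i ω, Y i ω))) P :=
    fun i _ => by simpa using (hid i).integrable_iff.2 hint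
  have h1 := measure_ge_le_exp_mul_mgf (μ := P) (t := 1) t zero_le_one
    (hind.integrable_exp_mul_sum hZ hints)
  rw [hind.mgf_sum hZ] at h1
  simp only [Finset.sum_apply] at h1
  refine h1.trans ?_
  have h2 : ∏ i ∈ Finset.range n, mgf (fun ω => φ (X i ω, Y i ω)) P 1 ≤ Real.exp a ^ n := by
    rw [← Finset.card_range n, ← Finset.prod_const, Finset.card_range]
    refine Finset.prod_le_prod (fun i _ => mgf_nonneg) fun i _ => ?_
    simp only [mgf, one_mul]
    rw [(hid i).integral_eq]
    exact hle
  calc Real.exp (-1 * t) * ∏ i ∈ Finset.range n, mgf (fun ω => φ (X i ω, Y i ω)) P 1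
      ≤ Real.exp (-1 * t) * Real.exp a ^ n := by gcongr
    _ = _ := by rw [← Real.exp_nat_mul, ← Real.exp_add]; congr 1; ring

/-- Sub-Gaussian tail of the noise process at a bounded function. -/
theorem measureReal_noise_le (hX : ∀ i, Measurable (X i)) (hY : ∀ i, Measurable (Y i))
    (hindep : iIndepFun (fun i ω => (X i ω, Y i ω)) P)
    (hident : ∀ i, IdentDistrib (fun ω => (X i ω, Y i ω)) (fun ω => (X 0 ω, Y 0 ω)) P P)
    (hf₀ : Measurable f₀) (he : IsSubGaussianNoise P (X 0) (fun ω => Y 0 ω - f₀ (X 0 ω)) K)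
    {h : E → ℝ} (hh : Measurable h) {S : ℝ} (hS0 : 0 < S) (hS : ∀ x, |h x| ≤ S)
    (n : ℕ) {t : ℝ} (ht : 0 ≤ t) :
    P.real {ω | n * t ≤ ∑ i ∈ Finset.range n, (Y i ω - f₀ (X i ω)) * h (X i ω)}
      ≤ Real.exp (-(n * t ^ 2 / (4 * (1 + K) * S ^ 2))) := by
  have hK := he.pos
  -- the minimizer of the exponent `(1 + K) (l S)² - l t`
  obtain ⟨l, hl⟩ : ∃ l : ℝ, l = t / (2 * (1 + K) * S ^ 2) := ⟨_, rfl⟩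
  have hl0 : 0 ≤ l := by rw [hl]; positivity
  have hlS : ∀ x, |l * h x| ≤ l * S := fun x => by
    rw [abs_mul, abs_of_nonneg hl0]; exact mul_le_mul_of_nonneg_left (hS x) hl0
  have hint := he.integrable_mul_exp (hX 0) (hh.const_mul l) (measurable_const (a := (1 : ℝ))) hlS
    (W := 1) (fun _ => by simp)
  have hle := he.integral_mul_exp_mul_le (hX 0) (hh.const_mul l) (measurable_const (a := (1 : ℝ)))
    hlS (W := 1) (fun _ => zero_le_one) (fun _ => le_rfl)
  simp only [one_mul] at hint hle
  have hle2 : ∫ ω, Real.exp ((1 + K) * (l * h (X 0 ω)) ^ 2) ∂P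
      ≤ Real.exp ((1 + K) * (l * S) ^ 2) := by
    have hb : ∀ x, Real.exp ((1 + K) * (l * h x) ^ 2) ≤ Real.exp ((1 + K) * (l * S) ^ 2) :=
      fun x => Real.exp_le_exp.2 (mul_le_mul_of_nonneg_left
        (sq_le_sq' (abs_le.1 (hlS x)).1 (abs_le.1 (hlS x)).2) (by linarith))
    calc _ ≤ ∫ _ω, Real.exp ((1 + K) * (l * S) ^ 2) ∂P := by
          refine integral_mono (integrable_of_abs_le (hX 0)
            (f := fun x => Real.exp ((1 + K) * (l * h x) ^ 2)) (by fun_prop)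
            fun x => by rw [Real.abs_exp]; exact hb x) (integrable_const _) fun ω => hb _
      _ = _ := by simp
  have key := measureReal_le_sum_le hX hY hindep hident
    (φ := fun z => l * h z.1 * (z.2 - f₀ z.1)) (by fun_prop) hint (hle.trans hle2) n (l * (n * t))
  have hsub : {ω | n * t ≤ ∑ i ∈ Finset.range n, (Y i ω - f₀ (X i ω)) * h (X i ω)} ⊆
      {ω | l * (n * t) ≤ ∑ i ∈ Finset.range n, l * h (X i ω) * (Y i ω - f₀ (X i ω))} := by
    intro ω hω
    have := mul_le_mul_of_nonneg_left (show
      n * t ≤ ∑ i ∈ Finset.range n, (Y i ω - f₀ (X i ω)) * h (X i ω) from hω) hl0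
    rw [Finset.mul_sum] at this
    refine this.trans (le_of_eq (Finset.sum_congr rfl fun i _ => by ring))
  refine (measureReal_mono hsub).trans (key.trans (Real.exp_le_exp.2 (le_of_eq ?_)))
  rw [hl]
  field_simp
  ring

/-- One-sided tail of the noise process with quadratic offset: the offset compensates the variance,
so that the exponent gains a multiple of `n ∫ h²`. With the exponential parameter
`l = 1 / (16 (1 + K))`, the noise contributes `exp (l h² / 4)` and the offset `exp (-l h² / 2)`. -/
theorem measureReal_offset_le (hX : ∀ i, Measurable (X i)) (hY : ∀ i, Measurable (Y i))
    (hindep : iIndepFun (fun i ω => (X i ω, Y i ω)) P)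
    (hident : ∀ i, IdentDistrib (fun ω => (X i ω, Y i ω)) (fun ω => (X 0 ω, Y 0 ω)) P P)
    (hf₀ : Measurable f₀) (he : IsSubGaussianNoise P (X 0) (fun ω => Y 0 ω - f₀ (X 0 ω)) K)
    {h : E → ℝ} (hh : Measurable h) {S l κ : ℝ} (hS : ∀ x, |h x| ≤ S)
    (hl : l = 1 / (16 * (1 + K))) (hκ : κ = l / 4 * Real.exp (-(l / 4 * S ^ 2))) (n : ℕ) (A : ℝ) :
    P.real {ω | -(n * A) ≤ ∑ i ∈ Finset.range n,
        (2 * (Y i ω - f₀ (X i ω)) * h (X i ω) - h (X i ω) ^ 2 / 2)}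
      ≤ Real.exp (n * (l * A - κ * ∫ ω, h (X 0 ω) ^ 2 ∂P)) := by
  have hK := he.pos
  have hl0 : 0 < l := by rw [hl]; positivity
  have hlS : ∀ x, |2 * l * h x| ≤ 2 * l * S := fun x => by
    rw [abs_mul, abs_of_nonneg (by positivity)]
    exact mul_le_mul_of_nonneg_left (hS x) (by positivity)
  have hw : Measurable fun x => Real.exp (-(l / 2 * h x ^ 2)) := by fun_prop
  have hw1 : ∀ x, Real.exp (-(l / 2 * h x ^ 2)) ≤ 1 := fun x => by
    rw [Real.exp_le_one_iff]
    have : 0 ≤ l / 2 * h x ^ 2 := by positivity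
    linarith
  have hint := he.integrable_mul_exp (hX 0) (hh.const_mul (2 * l)) hw hlS (W := 1)
    (fun x => by rw [Real.abs_exp]; exact hw1 x)
  have hle := he.integral_mul_exp_mul_le (hX 0) (hh.const_mul (2 * l)) hw hlS (W := 1)
    (fun _ => (Real.exp_pos _).le) hw1
  have e1 : ∀ x, (1 + K) * (2 * l * h x) ^ 2 = l / 4 * h x ^ 2 := fun x => by
    rw [hl]; field_simp; ring
  have e2 : ∀ x y : ℝ, Real.exp x * Real.exp y = Real.exp (x + y) := fun x y =>
    (Real.exp_add x y).symm
  simp only [e1, e2] at hint hle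
  have hsq : ∀ x, h x ^ 2 ≤ S ^ 2 := fun x => sq_le_sq' (abs_le.1 (hS x)).1 (abs_le.1 (hS x)).2
  have i2 : Integrable (fun ω => h (X 0 ω) ^ 2) P :=
    integrable_of_abs_le (hX 0) (f := fun x => h x ^ 2) (by fun_prop) (C := S ^ 2) fun x => by
      rw [abs_of_nonneg (sq_nonneg _)]; exact hsq x
  have hpt : ∀ x, Real.exp (-(l / 2 * h x ^ 2) + l / 4 * h x ^ 2) ≤ 1 - κ * h x ^ 2 := fun x => by
    have f1 : -(l / 2 * h x ^ 2) + l / 4 * h x ^ 2 = -(l / 4 * h x ^ 2) := by ring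
    rw [f1]
    have f2 := Real.add_one_le_exp (l / 4 * h x ^ 2)
    have f3 : Real.exp (-(l / 4 * h x ^ 2)) * (l / 4 * h x ^ 2 + 1) ≤ 1 := by
      calc _ ≤ Real.exp (-(l / 4 * h x ^ 2)) * Real.exp (l / 4 * h x ^ 2) := by gcongr
        _ = 1 := by rw [← Real.exp_add]; simp
    have f4 : Real.exp (-(l / 4 * S ^ 2)) ≤ Real.exp (-(l / 4 * h x ^ 2)) := by
      rw [Real.exp_le_exp]
      have := mul_le_mul_of_nonneg_left (hsq x) (show 0 ≤ l / 4 by positivity)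
      linarith
    have f5 : κ * h x ^ 2 ≤ Real.exp (-(l / 4 * h x ^ 2)) * (l / 4 * h x ^ 2) := by
      rw [hκ]
      have := mul_le_mul_of_nonneg_right f4 (show 0 ≤ l / 4 * h x ^ 2 by positivity)
      linarith
    linarith
  have hle2 : ∫ ω, Real.exp (-(l / 2 * h (X 0 ω) ^ 2) + l / 4 * h (X 0 ω) ^ 2) ∂P
      ≤ Real.exp (-(κ * ∫ ω, h (X 0 ω) ^ 2 ∂P)) := by
    calc _ ≤ ∫ ω, (1 - κ * h (X 0 ω) ^ 2) ∂P := by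
          refine integral_mono (integrable_of_abs_le (hX 0)
            (f := fun x => Real.exp (-(l / 2 * h x ^ 2) + l / 4 * h x ^ 2)) (by fun_prop) (C := 1)
            fun x => ?_) ((integrable_const _).sub (i2.const_mul κ)) fun ω => hpt _
          rw [Real.abs_exp, Real.exp_le_one_iff]
          have : 0 ≤ l / 4 * h x ^ 2 := by positivity
          linarith
      _ = 1 - κ * ∫ ω, h (X 0 ω) ^ 2 ∂P := by
          rw [integral_sub (integrable_const _) (i2.const_mul κ), integral_const_mul]; simp
      _ ≤ _ := by
          linarith [Real.add_one_le_exp (-(κ * ∫ ω, h (X 0 ω) ^ 2 ∂P))]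
  have key := measureReal_le_sum_le hX hY hindep hident
    (φ := fun z => -(l / 2 * h z.1 ^ 2) + 2 * l * h z.1 * (z.2 - f₀ z.1)) (by fun_prop) hint
    (hle.trans hle2) n (l * -(n * A))
  have hsub : {ω | -(n * A) ≤ ∑ i ∈ Finset.range n,
        (2 * (Y i ω - f₀ (X i ω)) * h (X i ω) - h (X i ω) ^ 2 / 2)} ⊆
      {ω | l * -(n * A) ≤ ∑ i ∈ Finset.range n,
        (-(l / 2 * h (X i ω) ^ 2) + 2 * l * h (X i ω) * (Y i ω - f₀ (X i ω)))} := by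
    intro ω hω
    have := mul_le_mul_of_nonneg_left (show -(n * A) ≤ ∑ i ∈ Finset.range n,
      (2 * (Y i ω - f₀ (X i ω)) * h (X i ω) - h (X i ω) ^ 2 / 2) from hω) hl0.le
    rw [Finset.mul_sum] at this
    refine this.trans (le_of_eq (Finset.sum_congr rfl fun i _ => by ring))
  refine (measureReal_mono hsub).trans (key.trans (Real.exp_le_exp.2 (le_of_eq ?_)))
  ring

end Chernoff

/-! ### Least squares over a class with polynomial entropy -/

theorem measureReal_iUnion_and_le {Ω : Type*} [MeasurableSpace Ω] {P : Measure Ω} {α : Type*}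
    [Fintype α] {c : α → Prop} {S : α → Set Ω} {b : ℝ} (hb : 0 ≤ b)
    (h : ∀ a, c a → P.real (S a) ≤ b) :
    P.real (⋃ a, {ω | c a ∧ ω ∈ S a}) ≤ Fintype.card α * b := by
  refine (measureReal_iUnion_fintype_le _).trans ?_
  calc ∑ a, P.real {ω | c a ∧ ω ∈ S a} ≤ ∑ _a : α, b := by
        refine Finset.sum_le_sum fun a _ => ?_
        by_cases ha : c a
        · simpa [ha] using h a ha
        · simpa [ha] using hb
    _ = _ := by simp

theorem sum_exp_neg_two_pow_mul_le {y : ℝ} (hy : 1 ≤ y) (m : ℕ) :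
    ∑ k ∈ Finset.range m, Real.exp (-(2 ^ k * y)) ≤ 2 * Real.exp (-y) := by
  have h1 : ∀ k : ℕ, Real.exp (-(2 ^ k * y)) ≤ Real.exp (-y) * (1 / 2) ^ k := fun k => by
    have h2 : (1 : ℝ) + k ≤ 2 ^ k := by
      have := one_add_mul_le_pow (show (-2 : ℝ) ≤ 1 by norm_num) k
      norm_num at this; linarith
    have h3 : Real.exp (-y) ≤ 1 / 2 := by
      rw [Real.exp_neg, one_div]
      exact inv_anti₀ two_pos (by linarith [Real.add_one_le_exp y])
    calc Real.exp (-(2 ^ k * y)) ≤ Real.exp (-y + k * -y) := Real.exp_le_exp.2 (by nlinarith)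
      _ = Real.exp (-y) * Real.exp (-y) ^ k := by rw [Real.exp_add, Real.exp_nat_mul]
      _ ≤ _ := by gcongr
  calc _ ≤ ∑ k ∈ Finset.range m, Real.exp (-y) * (1 / 2) ^ k := Finset.sum_le_sum fun k _ => h1 k
    _ = Real.exp (-y) * ∑ k ∈ Finset.range m, (1 / 2 : ℝ) ^ k := by rw [Finset.mul_sum]
    _ ≤ Real.exp (-y) * 2 := by
        gcongr
        exact sum_geometric_two_le m
    _ = _ := mul_comm _ _

/-- The deterministic part of chaining: along a chain `G 0, …, G m` of approximations of `g`, the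
least squares inequality for `g` forces the offset noise process at the coarsest approximation
`G 0` to be large. It uses `g² ≥ (G 0)² / 2 - (g - G 0)²`. -/
theorem neg_le_sum_offset_of_chain {n m : ℕ} {e g : ℕ → ℝ} {G : ℕ → ℕ → ℝ} {b τ r : ℝ}
    (hr : 0 ≤ r) (hτ : 0 ≤ τ) (hnoise : ∑ l ∈ Finset.range n, |e l| ≤ n * b)
    (hls : ∑ l ∈ Finset.range n, (e l - g l) ^ 2 ≤ ∑ l ∈ Finset.range n, e l ^ 2)
    (hlink : ∀ k < m, ∑ l ∈ Finset.range n, e l * (G (k + 1) l - G k l) ≤ n * (τ * r * (1 / 2) ^ k))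
    (hfine : ∀ l, |g l - G m l| ≤ r) (hcoarse : ∀ l, (g l - G 0 l) ^ 2 ≤ r) :
    -(n * ((4 * τ + 2 * b + 1) * r)) ≤
      ∑ l ∈ Finset.range n, (2 * e l * G 0 l - G 0 l ^ 2 / 2) := by
  have hchain : ∑ l ∈ Finset.range n, e l * (G m l - G 0 l) ≤ n * (2 * τ * r) := by
    calc _ = ∑ l ∈ Finset.range n, ∑ k ∈ Finset.range m, e l * (G (k + 1) l - G k l) := by
          refine Finset.sum_congr rfl fun l _ => ?_
          rw [← Finset.mul_sum, Finset.sum_range_sub (fun k => G k l)]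
      _ = ∑ k ∈ Finset.range m, ∑ l ∈ Finset.range n, e l * (G (k + 1) l - G k l) :=
          Finset.sum_comm
      _ ≤ ∑ k ∈ Finset.range m, n * (τ * r * (1 / 2) ^ k) :=
          Finset.sum_le_sum fun k hk => hlink k (Finset.mem_range.1 hk)
      _ = n * (τ * r * ∑ k ∈ Finset.range m, (1 / 2 : ℝ) ^ k) := by simp only [Finset.mul_sum]
      _ ≤ n * (τ * r * 2) := by gcongr; exact sum_geometric_two_le m
      _ = _ := by ring
  have hlast : ∑ l ∈ Finset.range n, e l * (g l - G m l) ≤ n * (b * r) := by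
    calc _ ≤ ∑ l ∈ Finset.range n, |e l| * r := by
          refine Finset.sum_le_sum fun l _ => (le_abs_self _).trans ?_
          rw [abs_mul]
          gcongr
          exact hfine l
      _ = (∑ l ∈ Finset.range n, |e l|) * r := by rw [Finset.sum_mul]
      _ ≤ n * b * r := by gcongr
      _ = _ := by ring
  have h1 : ∀ l ∈ Finset.range n, e l ^ 2 - (e l - g l) ^ 2 ≤ (2 * e l * G 0 l - G 0 l ^ 2 / 2)
      + 2 * (e l * (G m l - G 0 l)) + 2 * (e l * (g l - G m l)) + r := by
    intro l _
    nlinarith [hcoarse l, sq_nonneg (G 0 l + 2 * (g l - G 0 l))]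
  have h2 := Finset.sum_le_sum h1
  rw [Finset.sum_add_distrib, Finset.sum_add_distrib, Finset.sum_add_distrib,
    Finset.sum_sub_distrib, ← Finset.mul_sum, ← Finset.mul_sum, Finset.sum_const,
    Finset.card_range, nsmul_eq_mul] at h2
  linarith

section Rate

variable {Ω E : Type*} [MeasurableSpace Ω] [MeasurableSpace E] {P : Measure Ω}
  [IsProbabilityMeasure P] {X : ℕ → Ω → E} {Y : ℕ → Ω → ℝ} {f₀ : E → ℝ} {K : ℝ}

theorem integral_sq_le_two_mul_add (hX : Measurable (X 0)) {u v : E → ℝ} (hu : Measurable u)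
    (hv : Measurable v) {a b c : ℝ} (hua : ∀ x, |u x| ≤ a) (hvb : ∀ x, |v x| ≤ b)
    (huv : ∀ x, (u x - v x) ^ 2 ≤ c) :
    ∫ ω, u (X 0 ω) ^ 2 ∂P ≤ 2 * ∫ ω, v (X 0 ω) ^ 2 ∂P + 2 * c := by
  have hsqi : ∀ {u : E → ℝ} {c : ℝ}, Measurable u → (∀ x, |u x| ≤ c) →
      Integrable (fun ω => u (X 0 ω) ^ 2) P := fun {u c} hu hc =>
    integrable_of_abs_le hX (f := fun x => u x ^ 2) (hu.pow_const 2) (C := c ^ 2) fun x => by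
      rw [abs_of_nonneg (sq_nonneg _)]
      exact sq_le_sq' (abs_le.1 (hc x)).1 (abs_le.1 (hc x)).2
  have i2 := hsqi hv hvb
  calc _ ≤ ∫ ω, (2 * v (X 0 ω) ^ 2 + 2 * c) ∂P := by
        refine integral_mono (hsqi hu hua) ((i2.const_mul 2).add (integrable_const _)) fun ω => ?_
        have := huv (X 0 ω)
        simp only
        nlinarith [sq_nonneg (v (X 0 ω) - (u (X 0 ω) - v (X 0 ω)))]
    _ = _ := by
        rw [integral_add (i2.const_mul 2) (integrable_const _), integral_const_mul]; simp

/-- The rate of least squares over a class `𝓕` of uniformly bounded functions whose sup-norm nets at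
scale `h²` have cardinality at most `exp (C / h)`. The rate is written through `y = n ^ (1 / 5)`,
for which `δ = 1 / y² = n ^ (-2 / 5)` solves `n δ² = δ ^ (-1 / 2) = y`. The event occurs only if the
offset process is large at a point of the coarsest net (`T`), or one of the chaining links at scale
`2⁻ᵏ / y` is long (`U k`). -/
theorem exists_leastSquares_rate (hX : ∀ i, Measurable (X i)) (hY : ∀ i, Measurable (Y i))
    (hindep : iIndepFun (fun i ω => (X i ω, Y i ω)) P)
    (hident : ∀ i, IdentDistrib (fun ω => (X i ω, Y i ω)) (fun ω => (X 0 ω, Y 0 ω)) P P)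
    (hf₀ : Measurable f₀) (he : IsSubGaussianNoise P (X 0) (fun ω => Y 0 ω - f₀ (X 0 ω)) K)
    {𝓕 : Set (E → ℝ)} (h𝓕 : ∀ f ∈ 𝓕, Measurable f) {B : ℝ}
    (hB : ∀ f ∈ 𝓕, ∀ x, |f x - f₀ x| ≤ B) {C : ℝ} (hC : 0 < C)
    (hent : ∀ h : ℝ, 0 < h → h ≤ 1 → ∃ (ι : Type) (_ : Fintype ι) (F : ι → E → ℝ),
      (Fintype.card ι : ℝ) ≤ Real.exp (C / h) ∧ (∀ i, Measurable (F i)) ∧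
      ∀ f ∈ 𝓕, ∃ i, ∀ x, |f x - F i x| ≤ h ^ 2) {b : ℝ} (hb : 0 < b) :
    ∃ M : ℝ, 0 < M ∧ ∀ (n : ℕ) (y : ℝ), 1 ≤ y → y ^ 5 = n →
      P.real {ω | ∃ f ∈ 𝓕, ∑ i ∈ Finset.range n, |Y i ω - f₀ (X i ω)| ≤ n * b ∧
        ∑ i ∈ Finset.range n, (Y i ω - f (X i ω)) ^ 2
          ≤ ∑ i ∈ Finset.range n, (Y i ω - f₀ (X i ω)) ^ 2 ∧
        M / y ^ 4 < ∫ ω, (f (X 0 ω) - f₀ (X 0 ω)) ^ 2 ∂P} ≤ 3 * Real.exp (-y) := by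
  have hK := he.pos
  -- `τ` makes the exponent of a link, `(3 C + 1) 4ᵏ y`, beat the entropy `3 C 2ᵏ y` of pairs, and
  -- `K₀` makes the exponent of the offset process beat the entropy `C y` of the coarsest net
  obtain ⟨τ, hτ⟩ : ∃ τ : ℝ, τ = Real.sqrt (16 * (1 + K) * (3 * C + 1)) := ⟨_, rfl⟩
  have hτ0 : 0 ≤ τ := by rw [hτ]; exact Real.sqrt_nonneg _
  have hτ2 : τ ^ 2 = 16 * (1 + K) * (3 * C + 1) := by
    rw [hτ]; exact Real.sq_sqrt (by positivity)
  obtain ⟨A, hA⟩ : ∃ A : ℝ, A = 4 * τ + 2 * b + 1 := ⟨_, rfl⟩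
  obtain ⟨l, hl⟩ : ∃ l : ℝ, l = 1 / (16 * (1 + K)) := ⟨_, rfl⟩
  obtain ⟨κ, hκ⟩ : ∃ κ : ℝ, κ = l / 4 * Real.exp (-(l / 4 * (B + 1) ^ 2)) := ⟨_, rfl⟩
  have hl0 : 0 < l := by rw [hl]; positivity
  have hκ0 : 0 < κ := by rw [hκ]; positivity
  have hA0 : 0 < A := by rw [hA]; positivity
  obtain ⟨K₀, hK₀⟩ : ∃ K₀ : ℝ, K₀ = (l * A + C + 1) / κ := ⟨_, rfl⟩
  have hK₀0 : 0 < K₀ := by rw [hK₀]; positivity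
  refine ⟨2 * K₀ + 2, by positivity, fun n y hy hyn => ?_⟩
  have hy0 : 0 < y := by linarith
  -- scales `s k = 2⁻ᵏ / y`, so that the sup-norm accuracy `(s k)²` is `4⁻ᵏ δ`
  obtain ⟨s, hs⟩ : ∃ s : ℕ → ℝ, s = fun k => 1 / (2 ^ k * y) := ⟨_, rfl⟩
  have hs0 : ∀ k, 0 < s k := fun k => by rw [hs]; positivity
  have hs1 : ∀ k, s k ≤ 1 := fun k => by
    rw [hs]; simp only
    rw [div_le_one (by positivity)]
    exact one_le_mul_of_one_le_of_one_le (one_le_pow₀ one_le_two) hy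
  have hCs : ∀ k, C / s k = C * 2 ^ k * y := fun k => by rw [hs]; field_simp
  have hsucc : ∀ k, s (k + 1) ^ 2 ≤ s k ^ 2 := fun k => by
    refine pow_le_pow_left₀ (hs0 _).le ?_ 2
    rw [hs]; simp only
    gcongr
    · norm_num
    · omega
  choose ι hι F hcard hFm hFnet using fun k => hent (s k) (hs0 k) (hs1 k)
  obtain ⟨m, hm⟩ : ∃ m : ℕ, s m ^ 2 ≤ 1 / y ^ 4 := by
    obtain ⟨m, hm⟩ := pow_unbounded_of_one_lt y one_lt_two
    refine ⟨m, ?_⟩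
    rw [hs]; simp only
    rw [div_pow, one_pow]
    gcongr
    rw [mul_pow, show y ^ 4 = y ^ 2 * y ^ 2 by ring]
    gcongr
  obtain ⟨t, ht⟩ : ∃ t : ℕ → ℝ, t = fun k => τ / y ^ 4 * (1 / 2) ^ k := ⟨_, rfl⟩
  have ht0 : ∀ k, 0 ≤ t k := fun k => by rw [ht]; positivity
  obtain ⟨T, hT⟩ : ∃ T : Set Ω, T = ⋃ i : ι 0, {ω | ((∀ x, |F 0 i x - f₀ x| ≤ B + 1) ∧
      K₀ / y ^ 4 ≤ ∫ ω, (F 0 i (X 0 ω) - f₀ (X 0 ω)) ^ 2 ∂P) ∧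
      ω ∈ {ω | -(n * (A / y ^ 4)) ≤ ∑ l ∈ Finset.range n,
        (2 * (Y l ω - f₀ (X l ω)) * (F 0 i (X l ω) - f₀ (X l ω))
          - (F 0 i (X l ω) - f₀ (X l ω)) ^ 2 / 2)}} := ⟨_, rfl⟩
  obtain ⟨U, hU⟩ : ∃ U : ℕ → Set Ω, U = fun k => ⋃ p : ι k × ι (k + 1),
      {ω | (∀ x, |F (k + 1) p.2 x - F k p.1 x| ≤ 2 * s k ^ 2) ∧
      ω ∈ {ω | n * t k ≤ ∑ l ∈ Finset.range n,
        (Y l ω - f₀ (X l ω)) * (F (k + 1) p.2 (X l ω) - F k p.1 (X l ω))}} := ⟨_, rfl⟩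
  have hPT : P.real T ≤ Real.exp (-y) := by
    rw [hT]
    refine (measureReal_iUnion_and_le (b := Real.exp (y * (l * A - κ * K₀)))
      (Real.exp_pos _).le fun i hi => ?_).trans ?_
    · refine (measureReal_offset_le hX hY hindep hident hf₀ he (h := fun x => F 0 i x - f₀ x)
        ((hFm 0 i).sub hf₀) hi.1 hl hκ n _).trans (Real.exp_le_exp.2 ?_)
      have h1 := mul_le_mul_of_nonneg_left hi.2 hκ0.le
      have h2 : (n : ℝ) * (l * (A / y ^ 4) - κ * (K₀ / y ^ 4)) = y * (l * A - κ * K₀) := by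
        rw [← hyn]; field_simp
      rw [← h2]
      gcongr
    · calc _ ≤ Real.exp (C / s 0) * Real.exp (y * (l * A - κ * K₀)) := by
            gcongr; exact hcard 0
        _ = Real.exp (C * y + y * (l * A - κ * K₀)) := by
            rw [hCs, ← Real.exp_add]; congr 1; ring
        _ ≤ _ := by
            rw [Real.exp_le_exp, hK₀]
            have : κ * ((l * A + C + 1) / κ) = l * A + C + 1 := by field_simp
            rw [this]
            exact le_of_eq (by ring)
  have hPU : ∀ k, P.real (U k) ≤ Real.exp (-(2 ^ k * y)) := fun k => by
    rw [hU]
    refine (measureReal_iUnion_and_le (b := Real.exp (-((3 * C + 1) * 2 ^ k * y)))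
      (Real.exp_pos _).le fun p hp => ?_).trans ?_
    · refine (measureReal_noise_le hX hY hindep hident hf₀ he
        (h := fun x => F (k + 1) p.2 x - F k p.1 x) ((hFm _ _).sub (hFm _ _))
        (mul_pos two_pos (pow_pos (hs0 k) 2)) hp n (ht0 k)).trans (Real.exp_le_exp.2 ?_)
      rw [neg_le_neg_iff]
      have h1 : (n : ℝ) * t k ^ 2 / (4 * (1 + K) * (2 * s k ^ 2) ^ 2) = (3 * C + 1) * 4 ^ k * y := by
        have h4 : (4 : ℝ) ^ k = 2 ^ k * 2 ^ k := by rw [← mul_pow]; norm_num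
        have h5 : (0 : ℝ) < 2 ^ k := by positivity
        have h6 : t k = τ / (y ^ 4 * 2 ^ k) := by
          rw [ht]; simp only; rw [one_div, inv_pow]; field_simp
        rw [h6, hs, ← hyn, div_pow, hτ2, h4]
        field_simp
        ring
      rw [h1]
      gcongr
      norm_num
    · rw [Fintype.card_prod]
      push_cast
      calc _ ≤ Real.exp (C / s k) * Real.exp (C / s (k + 1))
              * Real.exp (-((3 * C + 1) * 2 ^ k * y)) := by
            gcongr
            · exact hcard k
            · exact hcard (k + 1)
        _ = _ := by
            rw [hCs, hCs, ← Real.exp_add, ← Real.exp_add]; congr 1; ring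
  have hincl : {ω | ∃ f ∈ 𝓕, ∑ i ∈ Finset.range n, |Y i ω - f₀ (X i ω)| ≤ n * b ∧
        ∑ i ∈ Finset.range n, (Y i ω - f (X i ω)) ^ 2
          ≤ ∑ i ∈ Finset.range n, (Y i ω - f₀ (X i ω)) ^ 2 ∧
        (2 * K₀ + 2) / y ^ 4 < ∫ ω, (f (X 0 ω) - f₀ (X 0 ω)) ^ 2 ∂P}
      ⊆ T ∪ ⋃ k ∈ Finset.range m, U k := by
    rintro ω ⟨f, hf, hnoise, hls, hbig⟩
    by_contra hω
    rw [Set.mem_union, not_or] at hω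
    obtain ⟨hωT, hωU⟩ := hω
    choose i hi using fun k => hFnet k f hf
    have hsq0 : s 0 ^ 2 = 1 / y ^ 2 := by rw [hs]; simp
    have hcoarse : ∀ x, (f x - F 0 (i 0) x) ^ 2 ≤ 1 / y ^ 4 := fun x => by
      have h3 := hi 0 x
      rw [hsq0] at h3
      have := sq_le_sq' (abs_le.1 h3).1 (abs_le.1 h3).2
      rwa [div_pow, one_pow, ← pow_mul] at this
    have hlink : ∀ k < m, ∑ l ∈ Finset.range n, (Y l ω - f₀ (X l ω)) *
        (F (k + 1) (i (k + 1)) (X l ω) - F k (i k) (X l ω)) ≤ n * t k := by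
      intro k hk
      by_contra hcon
      refine hωU (Set.mem_biUnion (Finset.mem_range.2 hk) ?_)
      rw [hU]
      refine Set.mem_iUnion.2 ⟨(i k, i (k + 1)), fun x => ?_, (not_le.1 hcon).le⟩
      have a1 := abs_le.1 (hi k x)
      have a2 := abs_le.1 ((hi (k + 1) x).trans (hsucc k))
      simp only
      rw [abs_le]; constructor <;> linarith
    have htop := neg_le_sum_offset_of_chain (n := n) (m := m) (e := fun l => Y l ω - f₀ (X l ω))
      (g := fun l => f (X l ω) - f₀ (X l ω)) (G := fun k l => F k (i k) (X l ω) - f₀ (X l ω))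
      (r := 1 / y ^ 4) (by positivity) hτ0 hnoise (by simpa using hls)
      (fun k hk => by
        have := hlink k hk
        rw [ht] at this
        simpa [div_eq_mul_inv] using this)
      (fun l => by simpa using (hi m (X l ω)).trans hm)
      (fun l => by simpa using hcoarse (X l ω))
    rw [← hA, mul_one_div] at htop
    have hf0 : ∀ x, |F 0 (i 0) x - f₀ x| ≤ B + 1 := fun x => by
      have a1 := abs_le.1 (hB f hf x)
      have a2 := abs_le.1 ((hi 0 x).trans (pow_le_one₀ (hs0 0).le (hs1 0)))
      rw [abs_le]; constructor <;> linarith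
    have hsmall : ∫ ω, (F 0 (i 0) (X 0 ω) - f₀ (X 0 ω)) ^ 2 ∂P < K₀ / y ^ 4 := by
      by_contra hcon
      refine hωT ?_
      rw [hT]
      exact Set.mem_iUnion.2 ⟨i 0, ⟨hf0, not_lt.1 hcon⟩, htop⟩
    have hfin := integral_sq_le_two_mul_add (P := P) (c := 1 / y ^ 4) (hX 0) ((h𝓕 f hf).sub hf₀)
      ((hFm 0 (i 0)).sub hf₀) (hB f hf) hf0 fun x => by simpa using hcoarse x
    simp only [Pi.sub_apply] at hfin
    have : (2 * K₀ + 2) / y ^ 4 = 2 * (K₀ / y ^ 4) + 2 * (1 / y ^ 4) := by ring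
    linarith
  calc _ ≤ P.real (T ∪ ⋃ k ∈ Finset.range m, U k) := measureReal_mono hincl
    _ ≤ P.real T + P.real (⋃ k ∈ Finset.range m, U k) := measureReal_union_le _ _
    _ ≤ Real.exp (-y) + ∑ k ∈ Finset.range m, P.real (U k) := by
        gcongr
        exact measureReal_biUnion_finset_le _ _
    _ ≤ Real.exp (-y) + 2 * Real.exp (-y) := by
        gcongr
        exact (Finset.sum_le_sum fun k _ => hPU k).trans (sum_exp_neg_two_pow_mul_le hy m)
    _ = _ := by ring

end Rate

/-! ### The estimator and the single index class -/

/-- The conditional moment hypotheses, stated for an error `ε` that need not be measurable, give the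
noise condition for a measurable version `e` of it. -/
theorem isSubGaussianNoise_of_condExp {Ω E : Type*} [MeasurableSpace Ω] [MeasurableSpace E]
    {P : Measure Ω} [IsProbabilityMeasure P] {X : Ω → E} {e ε : Ω → ℝ} {K : ℝ} (hX : Measurable X)
    (he : Measurable e) (heq : ε =ᵐ[P] e) (hK : 0 < K)
    (hexp : Integrable (fun ω => Real.exp (ε ω ^ 2 / K)) P)
    (hsub : ∀ᵐ ω ∂P,
      K * (P[fun ω => Real.exp (ε ω ^ 2 / K) - 1 | MeasurableSpace.comap X inferInstance]) ω ≤ 1)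
    (hmean : P[ε | MeasurableSpace.comap X inferInstance] =ᵐ[P] 0) :
    IsSubGaussianNoise P X e K := by
  have hle : MeasurableSpace.comap X inferInstance ≤ (inferInstance : MeasurableSpace Ω) :=
    hX.comap_le
  have heq' : (fun ω => Real.exp (ε ω ^ 2 / K)) =ᵐ[P] fun ω => Real.exp (e ω ^ 2 / K) :=
    heq.mono fun ω h => by simp only [h]
  have heq1 : (fun ω => Real.exp (ε ω ^ 2 / K) - 1) =ᵐ[P] fun ω => Real.exp (e ω ^ 2 / K) - 1 :=
    heq.mono fun ω h => by simp only [h]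
  have hexp' : Integrable (fun ω => Real.exp (e ω ^ 2 / K)) P := hexp.congr heq'
  have hei : Integrable e P := by
    refine Integrable.mono' ((integrable_const 1).add (hexp'.const_mul K))
      he.aestronglyMeasurable (Eventually.of_forall fun ω => abs_le_one_add_mul_exp hK (e ω))
  have hpull : ∀ (b : E → ℝ) (g : Ω → ℝ), Measurable b → (∃ C, ∀ x, |b x| ≤ C) → Integrable g P →
      ∫ ω, b (X ω) * g ω ∂P
        = ∫ ω, b (X ω) * (P[g | MeasurableSpace.comap X inferInstance]) ω ∂P := by
    intro b g hb ⟨C, hC⟩ hg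
    have hbm : StronglyMeasurable[MeasurableSpace.comap X inferInstance] (fun ω => b (X ω)) :=
      (hb.comp (comap_measurable X)).stronglyMeasurable
    have hbg : Integrable ((fun ω => b (X ω)) * g) P :=
      hg.bdd_mul (hb.comp hX).aestronglyMeasurable (Eventually.of_forall fun ω => hC (X ω))
    have h1 := integral_condExp (μ := P) (f := (fun ω => b (X ω)) * g) hle
    rw [integral_congr_ae (condExp_mul_of_stronglyMeasurable_left hbm hbg hg)] at h1
    exact h1.symm
  refine ⟨hK, he, hexp', fun b hb hC => ?_, fun c hc hc0 hC => ?_⟩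
  · rw [hpull b e hb hC hei]
    have h1 : P[e | MeasurableSpace.comap X inferInstance] =ᵐ[P] 0 :=
      (condExp_congr_ae heq).symm.trans hmean
    rw [integral_congr_ae (g := fun _ => (0 : ℝ)) (h1.mono fun ω h => by simp [h])]
    simp
  · obtain ⟨C, hC⟩ := hC
    have hCabs : ∀ x, |c x| ≤ C := fun x => by rw [abs_of_nonneg (hc0 x)]; exact hC x
    have hci := integrable_of_abs_le (P := P) hX hc hCabs
    have hg : Integrable (fun ω => Real.exp (e ω ^ 2 / K) - 1) P :=
      hexp'.sub (integrable_const 1)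
    rw [hpull c _ hc ⟨C, hCabs⟩ hg, ← integral_div]
    refine integral_mono_ae (integrable_condExp.bdd_mul (hc.comp hX).aestronglyMeasurable
      (Eventually.of_forall fun ω => hCabs (X ω))) (hci.div_const K) ?_
    filter_upwards [hsub, condExp_congr_ae (m := MeasurableSpace.comap X inferInstance) heq1]
      with ω h1 h2
    rw [h2] at h1
    rw [div_eq_mul_one_div]
    refine mul_le_mul_of_nonneg_left ?_ (hc0 _)
    rw [le_div_iff₀ hK, mul_comm]; exact h1

section Estimator

variable {d : ℕ} [NeZero d] {D : Set ℝ} {L : ℝ≥0} {n : ℕ} {x : ℕ → EuclideanSpace ℝ (Fin d)}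
  {y : ℕ → ℝ} {m : ℝ → ℝ} {θ : EuclideanSpace ℝ (Fin d)}

theorem IsLLSE.sum_sq_le (h : IsLLSE D L n x y m θ) (hn : 1 ≤ n) {m' : ℝ → ℝ}
    (hm' : m' ∈ linkClass D L) {θ' : EuclideanSpace ℝ (Fin d)} (hθ' : θ' ∈ paramSpace d) :
    ∑ i ∈ Finset.range n, (y i - m (inner ℝ θ (x i))) ^ 2
      ≤ ∑ i ∈ Finset.range n, (y i - m' (inner ℝ θ' (x i))) ^ 2 := by
  have hn0 : (0 : ℝ) < n := by exact_mod_cast hn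
  exact le_of_mul_le_mul_left (h.2.2 m' hm' θ' hθ') (by positivity)

/-- The residuals of the estimator sum to zero, because constants may be added to the link. -/
theorem IsLLSE.sum_residual_eq_zero (h : IsLLSE D L n x y m θ) (hn : 1 ≤ n) :
    ∑ i ∈ Finset.range n, (y i - m (inner ℝ θ (x i))) = 0 := by
  have hn0 : (0 : ℝ) < n := by exact_mod_cast hn
  obtain ⟨r, hr⟩ : ∃ r : ℝ, r = ∑ i ∈ Finset.range n, (y i - m (inner ℝ θ (x i))) := ⟨_, rfl⟩
  have hm' : (fun t => m t + r / n) ∈ linkClass D L := by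
    refine ⟨h.1.1.add_const _, fun s hs t ht => ?_⟩
    simpa using h.1.2 hs ht
  have h1 := h.sum_sq_le hn hm' h.2.1
  have h2 : ∑ i ∈ Finset.range n, (y i - (m (inner ℝ θ (x i)) + r / n)) ^ 2
      = ∑ i ∈ Finset.range n, (y i - m (inner ℝ θ (x i))) ^ 2 - r ^ 2 / n := by
    have : ∀ i, (y i - (m (inner ℝ θ (x i)) + r / n)) ^ 2 = (y i - m (inner ℝ θ (x i))) ^ 2
        - 2 * (r / n) * (y i - m (inner ℝ θ (x i))) + (r / n) ^ 2 := fun i => by ring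
    simp_rw [this]
    rw [Finset.sum_add_distrib, Finset.sum_sub_distrib, ← Finset.mul_sum, ← hr, Finset.sum_const,
      Finset.card_range, nsmul_eq_mul]
    field_simp
    ring
  rw [h2] at h1
  have h3 : r ^ 2 / n ≤ 0 := by linarith
  have h4 : r ^ 2 ≤ 0 := by
    rw [div_le_iff₀ hn0, zero_mul] at h3; exact h3
  rw [← hr]
  exact pow_eq_zero_iff two_ne_zero |>.1 (le_antisymm h4 (sq_nonneg r))

end Estimator

/-- The point `s > t` of `D` ensures that `D` contains a right neighbourhood of `t`, on which the two
functions agree. -/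
theorem rightDeriv_eq_deriv_of_eqOn {D : Set ℝ} {m m' : ℝ → ℝ} (hD : Convex ℝ D)
    (h : Set.EqOn m' m D) {t s : ℝ} (ht : t ∈ D) (hs : s ∈ D) (hts : t < s)
    (hd : DifferentiableAt ℝ m' t) : rightDeriv m t = deriv m' t := by
  have h1 : m =ᶠ[nhdsWithin t (Set.Ioi t)] m' := by
    filter_upwards [Ioo_mem_nhdsGT hts] with u hu
    exact (h (hD.ordConnected.out ht hs ⟨hu.1.le, hu.2.le⟩)).symm
  rw [rightDeriv, h1.derivWithin_eq (h ht).symm]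
  exact hd.derivWithin (uniqueDiffWithinAt_Ioi t)

theorem l2norm_map {Ω E : Type*} [MeasurableSpace Ω] [MeasurableSpace E] {P : Measure Ω} {X : Ω → E}
    (hX : Measurable X) {g : E → ℝ} (hg : AEStronglyMeasurable g (P.map X)) :
    l2norm (P.map X) g = Real.sqrt (∫ ω, g (X ω) ^ 2 ∂P) := by
  rw [l2norm, integral_map hX.aemeasurable (f := fun x => g x ^ 2) (hg.pow 2)]

/-- Markov's inequality for the average absolute noise. -/
theorem measureReal_noise_average_le {Ω E : Type*} [MeasurableSpace Ω] [MeasurableSpace E]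
    {P : Measure Ω} [IsProbabilityMeasure P] {X : ℕ → Ω → E} {Y : ℕ → Ω → ℝ}
    (hident : ∀ i, IdentDistrib (fun ω => (X i ω, Y i ω)) (fun ω => (X 0 ω, Y 0 ω)) P P)
    {f₀ : E → ℝ} (hf₀ : Measurable f₀) (hint : Integrable (fun ω => Y 0 ω - f₀ (X 0 ω)) P)
    {b : ℝ} (hb : 0 < b) {n : ℕ} (hn : 1 ≤ n) :
    P.real {ω | n * b ≤ ∑ i ∈ Finset.range n, |Y i ω - f₀ (X i ω)|}
      ≤ (∫ ω, |Y 0 ω - f₀ (X 0 ω)| ∂P) / b := by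
  have hn0 : (0 : ℝ) < n := by exact_mod_cast hn
  have hid : ∀ i, IdentDistrib (fun ω => |Y i ω - f₀ (X i ω)|) (fun ω => |Y 0 ω - f₀ (X 0 ω)|) P P :=
    fun i => (hident i).comp (u := fun z : E × ℝ => |z.2 - f₀ z.1|) (by fun_prop)
  have hi : ∀ i ∈ Finset.range n, Integrable (fun ω => |Y i ω - f₀ (X i ω)|) P := fun i _ =>
    (hid i).integrable_iff.2 hint.abs
  have h1 := mul_meas_ge_le_integral_of_nonneg (μ := P)
    (f := fun ω => ∑ i ∈ Finset.range n, |Y i ω - f₀ (X i ω)|)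
    (Eventually.of_forall fun ω => Finset.sum_nonneg fun i _ => abs_nonneg _)
    (integrable_finsetSum _ hi) (n * b)
  rw [integral_finsetSum _ hi, Finset.sum_congr rfl fun i _ => (hid i).integral_eq,
    Finset.sum_const, Finset.card_range, nsmul_eq_mul, mul_assoc] at h1
  rw [le_div_iff₀ hb, mul_comm]
  exact le_of_mul_le_mul_left h1 hn0

/-- `E[X Xᵀ m₀'(θ₀ᵀX)²]` can only be nonsingular if the derivative of the link does not vanish almost
everywhere; here the link is replaced by an extension `m'` of it beyond `D`. -/
theorem not_ae_deriv_eq_zero_of_det_ne_zero {Ω : Type*} [MeasurableSpace Ω] {P : Measure Ω} {d : ℕ}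
    [NeZero d] {X : Ω → EuclideanSpace ℝ (Fin d)} (hX : Measurable X) {d₁ : ℕ} (hd₁ : 1 ≤ d₁)
    (hcont : ContinuousDiscrete P X d₁) {θ₀ : EuclideanSpace ℝ (Fin d)} (hpos : θ₀ 0 ≠ 0)
    {D : Set ℝ} (hD : Convex ℝ D) (hne : D.Nonempty) (hbdd : BddAbove D)
    (hmem : ∀ᵐ x ∂(P.map X), (inner ℝ θ₀ x : ℝ) ∈ D) {m m' : ℝ → ℝ} {L : ℝ≥0}
    (heq : Set.EqOn m' m D) (hm' : LipschitzWith L m')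
    (hdet : (Matrix.of fun i j : Fin d =>
      ∫ ω, X ω i * X ω j * rightDeriv m (inner ℝ θ₀ (X ω)) ^ 2 ∂P).det ≠ 0) :
    ¬ ∀ᵐ x ∂(P.map X), deriv m' (inner ℝ θ₀ x) = 0 := by
  intro h0
  have hnull : ∀ᵐ t : ℝ, t ≠ sSup D := by simp [ae_iff]
  have h1 : ∀ᵐ x ∂(P.map X), rightDeriv m (inner ℝ θ₀ x) = 0 := by
    filter_upwards [h0, hmem, ae_inner_of_ae_volume hX hd₁ hcont hpos hm'.ae_differentiableAt,
      ae_inner_of_ae_volume hX hd₁ hcont hpos hnull] with x a1 a2 a3 a4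
    obtain ⟨s, hs, hlt⟩ := exists_lt_of_lt_csSup hne (lt_of_le_of_ne (le_csSup hbdd a2) a4)
    rw [rightDeriv_eq_deriv_of_eqOn hD heq a2 hs hlt a3, a1]
  have h2 := ae_of_ae_map hX.aemeasurable h1
  refine hdet ?_
  have h3 : (Matrix.of fun i j : Fin d =>
      ∫ ω, X ω i * X ω j * rightDeriv m (inner ℝ θ₀ (X ω)) ^ 2 ∂P) = 0 := by
    ext i j
    rw [Matrix.of_apply, integral_congr_ae (g := fun _ => (0 : ℝ))
      (h2.mono fun ω hω => by simp [hω])]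
    simp
  rw [h3]
  exact Matrix.det_zero

/-- The class of functions `x ↦ m (θᵀx)` on `χ`, for convex `L`-Lipschitz links with `|m 0| ≤ B`. The
functions are set to zero off `χ`, so that sup norms over `χ` are sup norms over the whole space. -/
def singleIndexClass {d : ℕ} [NeZero d] (χ : Set (EuclideanSpace ℝ (Fin d))) (L : ℝ≥0) (B : ℝ) :
    Set (EuclideanSpace ℝ (Fin d) → ℝ) :=
  {f | ∃ m : ℝ → ℝ, ConvexOn ℝ Set.univ m ∧ LipschitzWith L m ∧ |m 0| ≤ B ∧
    ∃ θ ∈ paramSpace d, f = χ.indicator fun x => m (inner ℝ θ x)}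

section SingleIndexClass

variable {d : ℕ} [NeZero d] {χ : Set (EuclideanSpace ℝ (Fin d))} {L : ℝ≥0} {B R : ℝ}

theorem abs_comp_inner_sub_le {m : ℝ → ℝ} (hm : LipschitzWith L m) {θ x : EuclideanSpace ℝ (Fin d)}
    (hθ : θ ∈ paramSpace d) (hx : ‖x‖ ≤ R) : |m (inner ℝ θ x) - m 0| ≤ L * R := by
  have h1 := hm.dist_le_mul (inner ℝ θ x) 0
  rw [Real.dist_eq, Real.dist_eq, sub_zero] at h1
  refine h1.trans (mul_le_mul_of_nonneg_left ?_ L.coe_nonneg)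
  refine (abs_real_inner_le_norm _ _).trans ?_
  rwa [hθ.1, one_mul]

theorem measurable_of_mem_singleIndexClass (hχ : MeasurableSet χ)
    {f : EuclideanSpace ℝ (Fin d) → ℝ} (hf : f ∈ singleIndexClass χ L B) : Measurable f := by
  obtain ⟨m, -, hm, -, θ, -, rfl⟩ := hf
  exact (hm.continuous.comp (by fun_prop)).measurable.indicator hχ

theorem abs_le_of_mem_singleIndexClass (hB : 0 ≤ B) (hR0 : 0 ≤ R) (hR : ∀ x ∈ χ, ‖x‖ ≤ R)
    {f : EuclideanSpace ℝ (Fin d) → ℝ} (hf : f ∈ singleIndexClass χ L B)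
    (x : EuclideanSpace ℝ (Fin d)) : |f x| ≤ B + L * R := by
  obtain ⟨m, -, hm, hm0, θ, hθ, rfl⟩ := hf
  by_cases hx : x ∈ χ
  · rw [Set.indicator_of_mem hx]
    have a1 := abs_le.1 (abs_comp_inner_sub_le hm hθ (hR x hx))
    have a2 := abs_le.1 hm0
    rw [abs_le]; constructor <;> linarith
  · rw [Set.indicator_of_notMem hx, abs_zero]
    positivity

theorem exists_net_singleIndexClass (hχ : MeasurableSet χ) (hne : (paramSpace d).Nonempty)
    (L : ℝ≥0) (hB : 0 ≤ B) (hR0 : 0 ≤ R) (hR : ∀ x ∈ χ, ‖x‖ ≤ R) :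
    ∃ C : ℝ, 0 < C ∧ ∀ h : ℝ, 0 < h → h ≤ 1 →
      ∃ (ι : Type) (_ : Fintype ι) (F : ι → EuclideanSpace ℝ (Fin d) → ℝ),
      (Fintype.card ι : ℝ) ≤ Real.exp (C / h) ∧ (∀ i, Measurable (F i)) ∧
      ∀ f ∈ singleIndexClass χ L B, ∃ i, ∀ x, |f x - F i x| ≤ h ^ 2 := by
  obtain ⟨C, hC0, hnet⟩ := exists_net_singleIndex d hne L hB hR0
  refine ⟨C, hC0, fun h h0 h1 => ?_⟩
  obtain ⟨ι, hι, F, hF1, hF2, hF3⟩ := hnet h h0 h1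
  refine ⟨ι, hι, fun i => χ.indicator (F i), hF1, fun i => (hF2 i).measurable.indicator hχ, ?_⟩
  rintro _ ⟨m, hmc, hml, hm0, θ, hθ, rfl⟩
  obtain ⟨i, hi⟩ := hF3 m hmc hml hm0 θ hθ
  refine ⟨i, fun x => ?_⟩
  simp only
  by_cases hx : x ∈ χ
  · rw [Set.indicator_of_mem hx, Set.indicator_of_mem hx]; exact hi x (hR x hx)
  · rw [Set.indicator_of_notMem hx, Set.indicator_of_notMem hx, sub_zero, abs_zero]
    positivity

/-- A fitted link is bounded by the noise level, because the residuals sum to zero. -/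
theorem abs_zero_le_of_sum_residual_eq_zero {n : ℕ} (hn : 1 ≤ n)
    {x : ℕ → EuclideanSpace ℝ (Fin d)} {y : ℕ → ℝ} {m : ℝ → ℝ} {θ : EuclideanSpace ℝ (Fin d)}
    (hm : LipschitzWith L m) (hθ : θ ∈ paramSpace d) (hx : ∀ i, ‖x i‖ ≤ R)
    (hres : ∑ i ∈ Finset.range n, (y i - m (inner ℝ θ (x i))) = 0)
    {f₀ : EuclideanSpace ℝ (Fin d) → ℝ} {M₀ b : ℝ} (hf₀ : ∀ i, |f₀ (x i)| ≤ M₀)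
    (hb : ∑ i ∈ Finset.range n, |y i - f₀ (x i)| ≤ n * b) : |m 0| ≤ M₀ + b + L * R := by
  have hn0 : (0 : ℝ) < n := by exact_mod_cast hn
  have h2 : n * m 0 = ∑ i ∈ Finset.range n, (f₀ (x i) + (y i - f₀ (x i))
      - (m (inner ℝ θ (x i)) - m 0)) := by
    have : ∀ i, f₀ (x i) + (y i - f₀ (x i)) - (m (inner ℝ θ (x i)) - m 0)
        = (y i - m (inner ℝ θ (x i))) + m 0 := fun i => by ring
    simp_rw [this]
    rw [Finset.sum_add_distrib, hres, Finset.sum_const, Finset.card_range, nsmul_eq_mul, zero_add]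
  have h3 : |n * m 0| ≤ n * (M₀ + b + L * R) := by
    rw [h2]
    calc _ ≤ ∑ i ∈ Finset.range n, |f₀ (x i) + (y i - f₀ (x i)) - (m (inner ℝ θ (x i)) - m 0)| :=
          Finset.abs_sum_le_sum_abs _ _
      _ ≤ ∑ i ∈ Finset.range n, (|y i - f₀ (x i)| + (M₀ + L * R)) := by
          refine Finset.sum_le_sum fun i _ => ?_
          have a2 := abs_comp_inner_sub_le hm hθ (hx i)
          have a3 := abs_sub (f₀ (x i) + (y i - f₀ (x i))) (m (inner ℝ θ (x i)) - m 0)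
          have a4 := abs_add_le (f₀ (x i)) (y i - f₀ (x i))
          linarith [hf₀ i]
      _ ≤ n * b + n * (M₀ + L * R) := by
          rw [Finset.sum_add_distrib, Finset.sum_const, Finset.card_range, nsmul_eq_mul]
          linarith
      _ = n * (M₀ + b + L * R) := by ring
  rw [abs_mul, abs_of_pos hn0] at h3
  exact le_of_mul_le_mul_left h3 hn0

end SingleIndexClass

theorem l2norm_le_two_mul_add {E : Type*} [MeasurableSpace E] {μ : Measure E}
    [IsProbabilityMeasure μ] {u v : E → ℝ} (hu : MemLp u 2 μ) (hv : MemLp v 2 μ) {r s : ℝ}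
    (hr : l2norm μ v ≤ r) (hs : 0 ≤ s) (huv : ∀ᵐ x ∂μ, |u x - v x| ≤ s) :
    l2norm μ u ≤ 2 * (r + s) := by
  have hv0 : 0 ≤ l2norm μ v := Real.sqrt_nonneg _
  have hint : 0 ≤ ∫ x, v x ^ 2 ∂μ := integral_nonneg fun x => sq_nonneg _
  have hr2 : ∫ x, v x ^ 2 ∂μ ≤ r ^ 2 := by
    rw [← Real.sq_sqrt hint]
    exact pow_le_pow_left₀ hv0 hr 2
  refine Real.sqrt_le_iff.2 ⟨by linarith, ?_⟩
  calc ∫ x, u x ^ 2 ∂μ ≤ ∫ x, (2 * v x ^ 2 + 2 * s ^ 2) ∂μ := by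
        refine integral_mono_ae hu.integrable_sq
          ((hv.integrable_sq.const_mul 2).add (integrable_const _)) ?_
        filter_upwards [huv] with x hx
        have a2 := sq_le_sq' (abs_le.1 hx).1 (abs_le.1 hx).2
        nlinarith [sq_nonneg (v x - (u x - v x))]
    _ = 2 * ∫ x, v x ^ 2 ∂μ + 2 * s ^ 2 := by
        rw [integral_add (hv.integrable_sq.const_mul 2) (integrable_const _), integral_const_mul]
        simp
    _ ≤ (2 * (r + s)) ^ 2 := by nlinarith [mul_nonneg (hv0.trans hr) hs, sq_nonneg r, sq_nonneg s]

end ConvexSIM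

/-! ### Rates for the index and the link -/

theorem mainTheorem4 {Ω : Type*} [MeasurableSpace Ω] (P : Measure Ω) [IsProbabilityMeasure P]
    (d : ℕ) [NeZero d]
    -- the i.i.d. data
    (X : ℕ → Ω → EuclideanSpace ℝ (Fin d)) (Y : ℕ → Ω → ℝ)
    (hX : ∀ i, Measurable (X i)) (hY : ∀ i, Measurable (Y i))
    (hindep : iIndepFun (fun i ω => (X i ω, Y i ω)) P)
    (hident : ∀ i, IdentDistrib (fun ω => (X i ω, Y i ω)) (fun ω => (X 0 ω, Y 0 ω)) P P)
    -- the support of the covariate is compact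
    (χ : Set (EuclideanSpace ℝ (Fin d))) (hχ : χ = (P.map (X 0)).support)
    (hcompact : IsCompact χ)
    -- the convex link function, bounded and Lipschitz on `D`, and the index parameter
    (m₀ : ℝ → ℝ) (θ₀ : EuclideanSpace ℝ (Fin d)) (L₀ L : ℝ≥0) (hL : L₀ ≤ L)
    (hm₀ : m₀ ∈ ConvexSIM.linkClass (ConvexSIM.indexSet χ) L₀)
    (hbdd : ∃ M₀ : ℝ, 1 ≤ M₀ ∧ ∀ t ∈ ConvexSIM.indexSet χ, |m₀ t| ≤ M₀)
    (hθ₀ : θ₀ ∈ ConvexSIM.paramSpace d)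
    -- identifiability of the index: positive first coordinate, continuous and discrete covariates
    (hθ₀_pos : 0 < θ₀ 0)
    (d₁ : ℕ) (hd₁ : 1 ≤ d₁) (hd₁d : d₁ ≤ d)
    (hcont : ConvexSIM.ContinuousDiscrete P (X 0) d₁)
    -- the error `ε = Y - m₀(θ₀ᵀX)` is conditionally centred and uniformly sub-Gaussian
    (ε : Ω → ℝ) (hε : ε = fun ω => Y 0 ω - m₀ (inner ℝ θ₀ (X 0 ω)))
    (K₁ : ℝ) (hK₁ : 0 < K₁)
    (hexp : Integrable (fun ω => Real.exp (ε ω ^ 2 / K₁)) P)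
    (hsub : ∀ᵐ ω ∂P,
      K₁ * (P[fun ω => Real.exp (ε ω ^ 2 / K₁) - 1 | MeasurableSpace.comap (X 0) inferInstance]) ω
        ≤ 1)
    (hmean : P[ε | MeasurableSpace.comap (X 0) inferInstance] =ᵐ[P] 0)
    -- `E[X Xᵀ m₀'(θ₀ᵀX)²]` is nonsingular
    (hnonsing : (Matrix.of fun i j : Fin d =>
      ∫ ω, X 0 ω i * X 0 ω j * ConvexSIM.rightDeriv m₀ (inner ℝ θ₀ (X 0 ω)) ^ 2 ∂P).det ≠ 0)
    -- `Var(X)` is positive definite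
    (hvar : (Matrix.of fun i j : Fin d =>
      covariance (fun ω => X 0 ω i) (fun ω => X 0 ω j) P).PosDef)
    -- the conditional distribution of `X` given `θ₀ᵀX` is nondegenerate
    (hnondeg : ConvexSIM.NondegenerateGivenIndex P (X 0) θ₀)
    -- the estimator: any choice of a minimizer for every sample size
    (mhat : ℕ → Ω → ℝ → ℝ) (θhat : ℕ → Ω → EuclideanSpace ℝ (Fin d))
    (hLLSE : ∀ n, 1 ≤ n → ∀ᵐ ω ∂P,
      ConvexSIM.IsLLSE (ConvexSIM.indexSet χ) L n (fun i => X i ω) (fun i => Y i ω)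
        (mhat n ω) (θhat n ω)) :
    ConvexSIM.IsBigOP P (fun n ω => ‖θhat n ω - θ₀‖) (fun n => (n : ℝ) ^ (-(2 / 5) : ℝ)) ∧
    ConvexSIM.IsBigOP P
      (fun n ω => ConvexSIM.l2norm (P.map (X 0))
        (fun x => mhat n ω (inner ℝ θ₀ x) - m₀ (inner ℝ θ₀ x)))
      (fun n => (n : ℝ) ^ (-(2 / 5) : ℝ)) := by
  have hprob : IsProbabilityMeasure (P.map (X 0)) :=
    Measure.isProbabilityMeasure_map (hX 0).aemeasurable
  have hχae : ∀ᵐ x ∂(P.map (X 0)), x ∈ χ := by rw [hχ]; exact Measure.support_mem_ae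
  have hχm : MeasurableSet χ := hcompact.measurableSet
  have hXχ : ∀ᵐ ω ∂P, ∀ i, X i ω ∈ χ := by
    refine ae_all_iff.2 fun i => ae_of_ae_map (hX i).aemeasurable ?_
    have : P.map (X i) = P.map (X 0) := ((hident i).comp measurable_fst).map_eq
    rw [this]; exact hχae
  obtain ⟨R, hR0, hR⟩ : ∃ R : ℝ, 0 ≤ R ∧ ∀ x ∈ χ, ‖x‖ ≤ R := by
    obtain ⟨R, hR⟩ := hcompact.isBounded.exists_norm_le
    exact ⟨max R 0, le_max_right _ _, fun x hx => (hR x hx).trans (le_max_left _ _)⟩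
  obtain ⟨M₀, hM₀1, hM₀⟩ := hbdd
  have hmemD : ∀ x ∈ χ, ∀ θ ∈ ConvexSIM.paramSpace d, (inner ℝ θ x : ℝ) ∈ ConvexSIM.indexSet χ :=
    fun x hx θ hθ => ⟨x, hx, θ, hθ, rfl⟩
  have hinner : ∀ x ∈ χ, ∀ θ ∈ ConvexSIM.paramSpace d, |(inner ℝ θ x : ℝ)| ≤ R :=
    fun x hx θ hθ => by
      refine (abs_real_inner_le_norm _ _).trans ?_
      rw [hθ.1, one_mul]; exact hR x hx
  have hDne : (ConvexSIM.indexSet χ).Nonempty := by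
    obtain ⟨x, hx⟩ := hχae.exists
    exact ⟨_, hmemD x hx θ₀ hθ₀⟩
  obtain ⟨μ₀, hμ₀, hμ₀c, hμ₀l⟩ := ConvexSIM.exists_convex_lipschitz_extension hDne hm₀
  -- the regression function, modified off `χ` where the values of the link are uncontrolled
  obtain ⟨f₀, hf₀⟩ : ∃ f₀ : EuclideanSpace ℝ (Fin d) → ℝ,
      f₀ = χ.indicator fun x => μ₀ (inner ℝ θ₀ x) := ⟨_, rfl⟩
  have hf₀m : Measurable f₀ := by
    rw [hf₀]; exact (hμ₀l.continuous.comp (by fun_prop)).measurable.indicator hχm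
  have hf₀χ : ∀ x ∈ χ, f₀ x = m₀ (inner ℝ θ₀ x) := fun x hx => by
    rw [hf₀, Set.indicator_of_mem hx]; exact hμ₀ (hmemD x hx θ₀ hθ₀)
  have hf₀M : ∀ x, |f₀ x| ≤ M₀ := fun x => by
    by_cases hx : x ∈ χ
    · rw [hf₀χ x hx]; exact hM₀ _ (hmemD x hx θ₀ hθ₀)
    · rw [hf₀, Set.indicator_of_notMem hx, abs_zero]; linarith
  have hmemLp : ∀ g : EuclideanSpace ℝ (Fin d) → ℝ, Continuous g → MemLp g 2 (P.map (X 0)) := by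
    intro g hg
    obtain ⟨u, hu⟩ := hcompact.exists_bound_of_continuousOn hg.continuousOn
    exact MemLp.of_bound hg.aestronglyMeasurable u (hχae.mono fun x hx => hu x hx)
  have hεae : ε =ᵐ[P] fun ω => Y 0 ω - f₀ (X 0 ω) := by
    filter_upwards [hXχ] with ω hω
    rw [hε]; simp only; rw [hf₀χ _ (hω 0)]
  have hnoise : ConvexSIM.IsSubGaussianNoise P (X 0) (fun ω => Y 0 ω - f₀ (X 0 ω)) K₁ :=
    ConvexSIM.isSubGaussianNoise_of_condExp (hX 0) ((hY 0).sub (hf₀m.comp (hX 0))) hεae hK₁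
      hexp hsub hmean
  have hρ := ConvexSIM.not_ae_deriv_eq_zero_of_det_ne_zero (hX 0) hd₁ hcont hθ₀_pos.ne' hm₀.1.1 hDne
    ⟨R, by rintro _ ⟨x, hx, θ, hθ, rfl⟩; exact (abs_le.1 (hinner x hx θ hθ)).2⟩
    (hχae.mono fun x hx => hmemD x hx θ₀ hθ₀) hμ₀ hμ₀l hnonsing
  obtain ⟨c, hc0, hc⟩ := ConvexSIM.exists_norm_sub_le_mul_l2norm (L := L) (hX 0) hd₁ hcont hμ₀l hθ₀
    hθ₀_pos hnondeg hρ (hχae.mono fun x hx => hR x hx)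
  -- both errors are controlled on one event
  have main : ∀ e : ℝ, 0 < e → ∃ M : ℝ, 0 < M ∧ ∀ᶠ n : ℕ in atTop,
      P {ω | ¬ (‖θhat n ω - θ₀‖ ≤ M * (n : ℝ) ^ (-(2 / 5) : ℝ) ∧
        ConvexSIM.l2norm (P.map (X 0))
          (fun x => mhat n ω (inner ℝ θ₀ x) - m₀ (inner ℝ θ₀ x)) ≤ M * (n : ℝ) ^ (-(2 / 5) : ℝ))}
        ≤ ENNReal.ofReal e := by
    intro e he
    have hLR : 0 ≤ (L : ℝ) * R := mul_nonneg L.coe_nonneg hR0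
    -- the average absolute noise exceeds `b` with probability at most `e / 2`, for every `n`
    obtain ⟨b, hb⟩ : ∃ b : ℝ, b = 2 * (∫ ω, |Y 0 ω - f₀ (X 0 ω)| ∂P + 1) / e := ⟨_, rfl⟩
    have hI0 : 0 ≤ ∫ ω, |Y 0 ω - f₀ (X 0 ω)| ∂P := integral_nonneg fun ω => abs_nonneg _
    have hb0 : 0 < b := by rw [hb]; positivity
    have hIb : (∫ ω, |Y 0 ω - f₀ (X 0 ω)| ∂P) / b ≤ e / 2 := by
      rw [div_le_iff₀ hb0, hb]
      have : e / 2 * (2 * (∫ ω, |Y 0 ω - f₀ (X 0 ω)| ∂P + 1) / e)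
          = ∫ ω, |Y 0 ω - f₀ (X 0 ω)| ∂P + 1 := by field_simp
      rw [this]; linarith
    -- the resulting bound at the origin for the extended fitted link
    obtain ⟨B₁, hB₁⟩ : ∃ B₁ : ℝ, B₁ = M₀ + b + L * R := ⟨_, rfl⟩
    have hB₁0 : 0 ≤ B₁ := by rw [hB₁]; linarith
    obtain ⟨C, hC0, hnet⟩ := ConvexSIM.exists_net_singleIndexClass hχm ⟨θ₀, hθ₀⟩ L hB₁0 hR0 hR
    obtain ⟨M, hM0, hrate⟩ := ConvexSIM.exists_leastSquares_rate hX hY hindep hident hf₀m hnoise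
      (fun f hf => ConvexSIM.measurable_of_mem_singleIndexClass hχm hf)
      (B := B₁ + L * R + M₀)
      (fun f hf x => (abs_sub _ _).trans (add_le_add
        (ConvexSIM.abs_le_of_mem_singleIndexClass hB₁0 hR0 hR hf x) (hf₀M x))) hC0 hnet hb0
    obtain ⟨q, hq⟩ : ∃ q : ℝ, q = Real.sqrt M := ⟨_, rfl⟩
    have hq0 : 0 ≤ q := by rw [hq]; exact Real.sqrt_nonneg _
    have hqM : q ^ 2 = M := by rw [hq]; exact Real.sq_sqrt hM0.le
    refine ⟨c * q + 2 * (1 + L * R * c) * q + 1, by positivity, ?_⟩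
    have hylim : Tendsto (fun n : ℕ => (n : ℝ) ^ (1 / 5 : ℝ)) atTop atTop :=
      (tendsto_rpow_atTop (by norm_num)).comp tendsto_natCast_atTop_atTop
    have hexplim : Tendsto (fun n : ℕ => 3 * Real.exp (-((n : ℝ) ^ (1 / 5 : ℝ)))) atTop
        (nhds (3 * 0)) :=
      ((Real.tendsto_exp_neg_atTop_nhds_zero).comp hylim).const_mul 3
    filter_upwards [eventually_ge_atTop 1,
      hexplim.eventually_le_const (show 3 * (0 : ℝ) < e / 2 by linarith)] with n hn1 hnexp
    have hn0 : (0 : ℝ) < n := by exact_mod_cast hn1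
    obtain ⟨y, hy⟩ : ∃ y : ℝ, y = (n : ℝ) ^ (1 / 5 : ℝ) := ⟨_, rfl⟩
    rw [← hy] at hnexp
    have hy1 : 1 ≤ y := by rw [hy]; exact Real.one_le_rpow (by exact_mod_cast hn1) (by norm_num)
    have hy5 : y ^ 5 = n := by
      rw [hy, ← Real.rpow_natCast, ← Real.rpow_mul hn0.le]; norm_num
    have hy2 : (n : ℝ) ^ (-(2 / 5) : ℝ) = 1 / y ^ 2 := by
      rw [hy, ← Real.rpow_natCast, ← Real.rpow_mul hn0.le, one_div, ← Real.rpow_neg hn0.le]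
      norm_num
    have hy0 : 0 < y := by linarith
    -- the two bad events: large noise, and a far point of the class that fits as well as the truth
    obtain ⟨S₁, hS₁⟩ : ∃ S₁ : Set Ω,
      S₁ = {ω | n * b ≤ ∑ i ∈ Finset.range n, |Y i ω - f₀ (X i ω)|} := ⟨_, rfl⟩
    obtain ⟨S₂, hS₂⟩ : ∃ S₂ : Set Ω, S₂ = {ω | ∃ f ∈ ConvexSIM.singleIndexClass χ L B₁,
        ∑ i ∈ Finset.range n, |Y i ω - f₀ (X i ω)| ≤ n * b ∧
        ∑ i ∈ Finset.range n, (Y i ω - f (X i ω)) ^ 2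
          ≤ ∑ i ∈ Finset.range n, (Y i ω - f₀ (X i ω)) ^ 2 ∧
        M / y ^ 4 < ∫ ω, (f (X 0 ω) - f₀ (X 0 ω)) ^ 2 ∂P} := ⟨_, rfl⟩
    have hP₁ : P.real S₁ ≤ e / 2 := by
      rw [hS₁]
      exact (ConvexSIM.measureReal_noise_average_le hident hf₀m hnoise.integrable hb0 hn1).trans hIb
    have hP₂ : P.real S₂ ≤ e / 2 := by rw [hS₂]; exact (hrate n y hy1 hy5).trans hnexp
    have hae : ∀ᵐ ω ∂P, ω ∉ S₁ ∪ S₂ → (‖θhat n ω - θ₀‖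
        ≤ (c * q + 2 * (1 + L * R * c) * q + 1) * (n : ℝ) ^ (-(2 / 5) : ℝ) ∧
        ConvexSIM.l2norm (P.map (X 0))
          (fun x => mhat n ω (inner ℝ θ₀ x) - m₀ (inner ℝ θ₀ x))
          ≤ (c * q + 2 * (1 + L * R * c) * q + 1) * (n : ℝ) ^ (-(2 / 5) : ℝ)) := by
      filter_upwards [hLLSE n hn1, hXχ] with ω hls hωχ hω
      rw [Set.mem_union, not_or] at hω
      obtain ⟨hω₁, hω₂⟩ := hω
      have hθ := hls.2.1
      obtain ⟨m, hm, hmc, hml⟩ := ConvexSIM.exists_convex_lipschitz_extension hDne hls.1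
      have hfit : ∀ i, mhat n ω (inner ℝ (θhat n ω) (X i ω)) = m (inner ℝ (θhat n ω) (X i ω)) :=
        fun i => (hm (hmemD _ (hωχ i) _ hθ)).symm
      have hnb : ∑ i ∈ Finset.range n, |Y i ω - f₀ (X i ω)| ≤ n * b := by
        by_contra hcon
        refine hω₁ ?_
        rw [hS₁]; exact (not_le.1 hcon).le
      have hres := hls.sum_residual_eq_zero hn1
      simp_rw [hfit] at hres
      have hm0 : |m 0| ≤ B₁ := by
        rw [hB₁]
        exact ConvexSIM.abs_zero_le_of_sum_residual_eq_zero hn1 hml hθ (fun i => hR _ (hωχ i)) hres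
          (fun i => hf₀M _) hnb
      obtain ⟨f, hf⟩ : ∃ f : EuclideanSpace ℝ (Fin d) → ℝ,
        f = χ.indicator fun x => m (inner ℝ (θhat n ω) x) := ⟨_, rfl⟩
      have hf𝓕 : f ∈ ConvexSIM.singleIndexClass χ L B₁ := ⟨m, hmc, hml, hm0, _, hθ, hf⟩
      have hsq : ∑ i ∈ Finset.range n, (Y i ω - f (X i ω)) ^ 2
          ≤ ∑ i ∈ Finset.range n, (Y i ω - f₀ (X i ω)) ^ 2 := by
        have h1 := hls.sum_sq_le hn1 (m' := m₀) ⟨hm₀.1, hm₀.2.weaken hL⟩ hθ₀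
        refine (le_of_eq ?_).trans (h1.trans (le_of_eq ?_))
        · refine Finset.sum_congr rfl fun i _ => ?_
          rw [hfit, hf, Set.indicator_of_mem (hωχ i)]
        · refine Finset.sum_congr rfl fun i _ => ?_
          rw [hf₀χ _ (hωχ i)]
      have hint : ∫ ω, (f (X 0 ω) - f₀ (X 0 ω)) ^ 2 ∂P ≤ M / y ^ 4 := by
        by_contra hcon
        refine hω₂ ?_
        rw [hS₂]; exact ⟨f, hf𝓕, hnb, hsq, not_le.1 hcon⟩
      have hcm : Continuous fun x : EuclideanSpace ℝ (Fin d) =>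
          m (inner ℝ (θhat n ω) x) - μ₀ (inner ℝ θ₀ x) :=
        (hml.continuous.comp (by fun_prop)).sub (hμ₀l.continuous.comp (by fun_prop))
      have hint' : ∫ ω', (m (inner ℝ (θhat n ω) (X 0 ω')) - μ₀ (inner ℝ θ₀ (X 0 ω'))) ^ 2 ∂P
          ≤ M / y ^ 4 := by
        refine (le_of_eq (integral_congr_ae ?_)).trans hint
        filter_upwards [hXχ] with ω' hω'
        rw [hf, hf₀, Set.indicator_of_mem (hω' 0), Set.indicator_of_mem (hω' 0)]
      have hMy : M / y ^ 4 = (q / y ^ 2) ^ 2 := by rw [← hqM]; field_simp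
      have hl2 : ConvexSIM.l2norm (P.map (X 0))
          (fun x => m (inner ℝ (θhat n ω) x) - μ₀ (inner ℝ θ₀ x)) ≤ q / y ^ 2 := by
        rw [ConvexSIM.l2norm_map (hX 0) hcm.aestronglyMeasurable]
        refine Real.sqrt_le_iff.2 ⟨by positivity, ?_⟩
        rw [← hMy]; exact hint'
      have hθerr : ‖θhat n ω - θ₀‖ ≤ c * (q / y ^ 2) :=
        (hc m hmc hml _ hθ).trans (mul_le_mul_of_nonneg_left hl2 hc0.le)
      have hcm0 : Continuous fun x : EuclideanSpace ℝ (Fin d) =>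
          m (inner ℝ θ₀ x) - μ₀ (inner ℝ θ₀ x) :=
        (hml.continuous.comp (by fun_prop)).sub (hμ₀l.continuous.comp (by fun_prop))
      have hl2' : ConvexSIM.l2norm (P.map (X 0))
          (fun x => mhat n ω (inner ℝ θ₀ x) - m₀ (inner ℝ θ₀ x))
          ≤ 2 * (q / y ^ 2 + L * R * (c * (q / y ^ 2))) := by
        have e1 : ConvexSIM.l2norm (P.map (X 0))
            (fun x => mhat n ω (inner ℝ θ₀ x) - m₀ (inner ℝ θ₀ x))
            = ConvexSIM.l2norm (P.map (X 0)) (fun x => m (inner ℝ θ₀ x) - μ₀ (inner ℝ θ₀ x)) := by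
          rw [ConvexSIM.l2norm, ConvexSIM.l2norm]
          congr 1
          refine integral_congr_ae (hχae.mono fun x hx => ?_)
          simp only
          rw [hm (hmemD x hx θ₀ hθ₀), hμ₀ (hmemD x hx θ₀ hθ₀)]
        rw [e1]
        refine ConvexSIM.l2norm_le_two_mul_add (hmemLp _ hcm0) (hmemLp _ hcm) hl2
          (by positivity) (hχae.mono fun x hx => ?_)
        have h1 := hml.dist_le_mul (inner ℝ θ₀ x) (inner ℝ (θhat n ω) x)
        rw [Real.dist_eq, Real.dist_eq, ← inner_sub_left] at h1
        rw [sub_sub_sub_cancel_right]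
        refine h1.trans ?_
        rw [mul_assoc]
        refine mul_le_mul_of_nonneg_left ((abs_real_inner_le_norm _ _).trans ?_) L.coe_nonneg
        rw [mul_comm R, norm_sub_rev]
        exact mul_le_mul hθerr (hR x hx) (norm_nonneg _) (by positivity)
      have hsplit : (c * q + 2 * (1 + L * R * c) * q + 1) * (n : ℝ) ^ (-(2 / 5) : ℝ)
          = c * (q / y ^ 2) + 2 * (q / y ^ 2 + L * R * (c * (q / y ^ 2))) + 1 / y ^ 2 := by
        rw [hy2]; ring
      rw [hsplit]
      have p1 : 0 ≤ c * (q / y ^ 2) := by positivity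
      have p2 : 0 ≤ 2 * (q / y ^ 2 + L * R * (c * (q / y ^ 2))) := by positivity
      have p3 : 0 ≤ 1 / y ^ 2 := by positivity
      exact ⟨by linarith, by linarith⟩
    calc _ ≤ P (S₁ ∪ S₂) := measure_mono_ae (hae.mono fun ω h hbad => by
            by_contra hcon
            exact hbad (h hcon))
      _ = ENNReal.ofReal (P.real (S₁ ∪ S₂)) := (ofReal_measureReal (measure_ne_top _ _)).symm
      _ ≤ ENNReal.ofReal e := ENNReal.ofReal_le_ofReal (by
          have := measureReal_union_le (μ := P) S₁ S₂
          linarith)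
  constructor
  · intro e he
    obtain ⟨M, hM0, hM⟩ := main e he
    refine ⟨M, hM0, hM.mono fun n hn => (measure_mono fun ω hω => ?_).trans hn⟩
    intro hcon
    have hω' : M * (n : ℝ) ^ (-(2 / 5) : ℝ) < |‖θhat n ω - θ₀‖| := hω
    rw [abs_of_nonneg (norm_nonneg _)] at hω'
    exact absurd hcon.1 (not_le.2 hω')
  · intro e he
    obtain ⟨M, hM0, hM⟩ := main e he
    refine ⟨M, hM0, hM.mono fun n hn => (measure_mono fun ω hω => ?_).trans hn⟩
    intro hcon
    have hω' : M * (n : ℝ) ^ (-(2 / 5) : ℝ) < |ConvexSIM.l2norm (P.map (X 0))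
      (fun x => mhat n ω (inner ℝ θ₀ x) - m₀ (inner ℝ θ₀ x))| := hω
    rw [abs_of_nonneg (show 0 ≤ ConvexSIM.l2norm (P.map (X 0)) _ from Real.sqrt_nonneg _)] at hω'
    exact absurd hcon.2 (not_le.2 hω')
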